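/- Let $\varphi:\mathbb R\to\mathbb R$ be continuously differentiable with $M:=\sup_x|\varphi'(x)|<\infty$, let $\mathrm Z=\{x:\varphi(x)=0\}$, and let $\mu$ be a probability distribution on $\mathbb R$ with zero mean and finite variance $S$ such that: for some $L>0$ every nondegenerate interval $I\subset[-L,L]$ has $\mu(I)>0$; $\mu$ has no atoms; and $\mu((0,\infty))=\mu((-\infty,0))=1/2$. For sets $A,B\subset\mathbb R$ put $\partial(A,B)=\sup_{x\in A}\inf_{y\in B}|x-y|\in[0,\infty]$. Then there is a family of sets $\mathcal U(\lambda)\subset\mathbb R$, $0<\lambda<1$, depending only on $\varphi$ and $\mu$, which is monotone decreasing ($\mathcal U(\lambda')\subset\mathcal U(\lambda)$ for $\lambda\le\lambda'$) and satisfies $\mathcal U(\lambda)\supset\mathrm Z$ for all $\lambda$, such that the following holds for every $\bar{\mathrm g}$ with $0<\bar{\mathrm g}<2/M$ for which there is $R>0$ with $x\varphi(x)>0$ for $|x|\ge R$ and $$\inf_{|x|\ge R}\varphi^2(x)>\frac{\bar{\mathrm g}MS}{2-\bar{\mathrm g}M}.$$ First, $\partial(\mathcal U(\lambda),\mathrm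 Z)\to0$ as $\lambda\to1^-$. Second, let $0<d<1<u$, and on a probability space let $x_t,\gamma_t,\xi_t$ ($t\ge0$) and $y_t$ ($t\ge1$) be real random variables, with $x_0$ arbitrary and $\gamma_0,\gamma_1\in(0,\bar{\mathrm g}]$, such that $$y_t=\varphi(x_{t-1})+\xi_t,\qquad x_t=x_{t-1}-\gamma_{t-1}y_t\qquad(t\ge1),$$ $$\gamma_t=\begin{cases}\min\{u\gamma_{t-1},\bar{\mathrm g}\}&\text{if }y_{t-1}y_t>0,\\ d\,\gamma_{t-1}&\text{if }y_{t-1}y_t\le0,\end{cases}\qquad(t\ge2),$$ and such that for every $t\ge0$ the variable $\xi_{t+1}$ has distribution $\mu$ and is independent of the $\sigma$-algebra generated by $x_i,\gamma_i,\xi_i$, $0\le i\le t$. Then: (a) if $ud<1$, then almost surely $x_t$ converges to a point of $\mathcal U\!\left(\frac{\ln u}{-\ln d}\right)$; (b) if $ud>1$, then almost surely $x_t$ diverges (has no limit in $\mathbb R$). -/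

import Mathlib

open MeasureTheory ProbabilityTheory Filter Topology Set
open scoped ENNReal

namespace StochApprox

/-- The set of zeros of `φ`. -/
def zeroSet (φ : ℝ → ℝ) : Set ℝ := {x | φ x = 0}

/-- The one-sided deviation `sup_{x ∈ A} inf_{y ∈ B} |x - y|`, with values in `[0, ∞]`. -/
noncomputable def deviation (A B : Set ℝ) : ℝ≥0∞ :=
  ⨆ x ∈ A, ⨅ y ∈ B, ENNReal.ofReal |x - y|

/-- `φ` is continuously differentiable with bounded derivative. -/
def SmoothBounded (φ : ℝ → ℝ) : Prop :=
  ContDiff ℝ 1 φ ∧ BddAbove (range fun x => |deriv φ x|)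

/-- The constant `M = sup_x |φ'(x)|`. -/
noncomputable def derivSup (φ : ℝ → ℝ) : ℝ := ⨆ x, |deriv φ x|

/-- The law `μ` of the noise has finite variance and zero mean. -/
def CenteredFiniteVariance (μ : Measure ℝ) : Prop :=
  MemLp (fun z : ℝ => z) 2 μ ∧ ∫ z, z ∂μ = 0

/-- The variance `S` of the noise, in terms of its law. -/
noncomputable def noiseVariance (μ : Measure ℝ) : ℝ := variance (fun z : ℝ => z) μ

/-- The law of the noise charges every nondegenerate interval contained in some `[-L, L]`, `L > 0`,
and does not charge `0`. -/
def SpreadNearZero (μ : Measure ℝ) : Prop :=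
  (∃ L : ℝ, 0 < L ∧ ∀ a b : ℝ, -L ≤ a → a < b → b ≤ L → 0 < μ (Ioo a b)) ∧ μ {0} = 0

/-- Behaviour of `φ` far from the origin, for the maximal step size `gbar`: there is `R > 0` with
`x φ(x) > 0` for `|x| ≥ R`, and `inf_{|x| ≥ R} φ(x)² > gbar M S / (2 - gbar M)`. -/
def TailCondition (φ : ℝ → ℝ) (μ : Measure ℝ) (gbar : ℝ) : Prop :=
  ∃ R : ℝ, 0 < R ∧ (∀ x : ℝ, R ≤ |x| → 0 < x * φ x) ∧
    gbar * derivSup φ * noiseVariance μ / (2 - gbar * derivSup φ)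
      < sInf ((fun x => φ x ^ 2) '' {x : ℝ | R ≤ |x|})

/-- The σ-algebra generated by `x i`, `γ i`, `ξ i` for `0 ≤ i ≤ t`. -/
def history {Ω : Type*} (x γ ξ : ℕ → Ω → ℝ) (t : ℕ) : MeasurableSpace Ω :=
  ⨆ i : ℕ, ⨆ _ : i ≤ t,
    MeasurableSpace.comap (x i) inferInstance ⊔ MeasurableSpace.comap (γ i) inferInstance ⊔
      MeasurableSpace.comap (ξ i) inferInstance

/-- `x` (iterates), `γ` (step sizes), `y` (measurements) and `ξ` (noise) form a run of the algorithm
with parameters `u`, `d`, `gbar`. The initial data `x 0`, `γ 0`, `γ 1` are random variables.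
The values `ξ 0` and `y 0` do not enter the dynamics. -/
structure IsRun {Ω : Type*} [MeasurableSpace Ω] (φ : ℝ → ℝ) (u d gbar : ℝ)
    (x γ y ξ : ℕ → Ω → ℝ) : Prop where
  measurable_noise : ∀ t, Measurable (ξ t)
  measurable_x_zero : Measurable (x 0)
  measurable_γ_zero : Measurable (γ 0)
  measurable_γ_one : Measurable (γ 1)
  γ_zero_mem : ∀ ω, γ 0 ω ∈ Ioc 0 gbar
  γ_one_mem : ∀ ω, γ 1 ω ∈ Ioc 0 gbar
  measurement : ∀ t ω, y (t + 1) ω = φ (x t ω) + ξ (t + 1) ω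
  step : ∀ t ω, x (t + 1) ω = x t ω - γ t ω * y (t + 1) ω
  stepSize_same : ∀ t ω, 0 < y (t + 1) ω * y (t + 2) ω →
    γ (t + 2) ω = min (u * γ (t + 1) ω) gbar
  stepSize_change : ∀ t ω, y (t + 1) ω * y (t + 2) ω ≤ 0 →
    γ (t + 2) ω = d * γ (t + 1) ω

/-- Each `ξ (t + 1)` is independent of the history up to time `t` and has law `μ`. -/
def NoiseCondition {Ω : Type*} [MeasurableSpace Ω] (P : Measure Ω) (μ : Measure ℝ)
    (x γ ξ : ℕ → Ω → ℝ) : Prop :=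
  ∀ t, Indep (MeasurableSpace.comap (ξ (t + 1)) inferInstance) (history x γ ξ t) P ∧
    P.map (ξ (t + 1)) = μ

end StochApprox

/-! The triples (iterate, step size, last measurement) form a Markov chain. Let p and q be the
probabilities of a positive and a negative measurement at x, so p + q = 1. If the iterate were
frozen at x, the signs would be independent and a small step size would have mean logarithmic growth
(p² + q²) log u + 2pq log d. The set U(a) is `limitSet`: for a = log u / (-log d) it says exactly
that this growth is nonpositive. It shrinks to the zeros as a → 1 because, by compactness and the
tail condition, p and q stay away from 1/2 away from the zeros.

Limits lie in U (`ae_growth_nonpos_of_tendsto`). Near a point of positive growth, minus the log step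
size, corrected by the sign of the last measurement, has mean drift at most -θ until the cap is
nearly reached. Hence the step size is of order `gbar` infinitely often, and then the noise makes
increments of a fixed size infinitely often, which contradicts convergence. If ud > 1, the growth is
positive at every point, so no limit exists.

Convergence for ud < 1 (`ae_exists_tendsto`) combines three mechanisms. Trap: where φ is small, sign
changes have conditional probability close to 1/2, so a small power of the step size is a
supermartingale with geometric decay. From a small step size, the path has length too short to leave
this region with probability at least 1/2; by Lévy's zero-one law, infinitely many such visits force
convergence. Descent: where φ² dominates the noise term, the antiderivative of φ decreases in mean
by an amount controlling the mean increment, so a path that eventually stays there has finite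
length. Return: the other states have φ small, or bounded potential and a step size bounded below.
From the latter, a bounded number of low-noise steps, each of probability bounded below, leads to
small φ; alternating measurements then shrink the step size into the trap. -/

namespace StochApprox

/-! ### Markov chains driven by i.i.d. noise: zero-one law and Lyapunov estimates -/

section Chain

variable {Ω E : Type*} [mΩ : MeasurableSpace Ω] [MeasurableSpace E]

/-- `s` is a Markov chain driven by i.i.d. noise `ζ` of law `μ` through the update map `F`. -/
structure IsChain (P : Measure Ω) (μ : Measure ℝ) (F : E → ℝ → E) (ℱ : Filtration ℕ mΩ)
    (s : ℕ → Ω → E) (ζ : ℕ → Ω → ℝ) : Prop where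
  measurable_update : Measurable (fun p : E × ℝ => F p.1 p.2)
  adapted : ∀ t, Measurable[ℱ t] (s t)
  measurable_noise : ∀ t, Measurable (ζ t)
  indep : ∀ t, Indep (MeasurableSpace.comap (ζ t) inferInstance) (ℱ t) P
  law : ∀ t, P.map (ζ t) = μ
  step : ∀ t ω, s (t + 1) ω = F (s t ω) (ζ t ω)

set_option linter.unusedSectionVars false

variable {P : Measure Ω} [IsProbabilityMeasure P] {μ : Measure ℝ} [IsProbabilityMeasure μ]
  {F : E → ℝ → E} {ℱ : Filtration ℕ mΩ} {s : ℕ → Ω → E} {ζ : ℕ → Ω → ℝ}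

theorem IsChain.measurable (h : IsChain P μ F ℱ s ζ) (t : ℕ) : Measurable (s t) :=
  (h.adapted t).mono (ℱ.le t) le_rfl

/-- Integrating a function of the present state and the next noise over a past event. -/
theorem IsChain.setLIntegral_eq (h : IsChain P μ F ℱ s ζ) (t : ℕ) {A : Set Ω}
    (hA : MeasurableSet[ℱ t] A) {g : E × ℝ → ℝ≥0∞} (hg : Measurable g) :
    ∫⁻ ω in A, g (s t ω, ζ t ω) ∂P = ∫⁻ ω in A, ∫⁻ z, g (s t ω, z) ∂μ ∂P := by
  have hA' := ℱ.le t _ hA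
  have hs := h.measurable t
  have hζ := h.measurable_noise t
  -- Pairing the indicator of `A` with the state gives a variable of the past, independent of the
  -- noise; the claim is then Tonelli for the product law.
  set a : Ω → ℝ≥0∞ := A.indicator 1 with ha
  have ham : Measurable[ℱ t] a := Measurable.indicator measurable_const hA
  have ham' : Measurable a := ham.mono (ℱ.le t) le_rfl
  have hX : Measurable (fun ω => (a ω, s t ω)) := ham'.prodMk hs
  have hind : IndepFun (fun ω => (a ω, s t ω)) (ζ t) P := by
    rw [IndepFun_iff_Indep]
    refine indep_of_indep_of_le_left (h.indep t).symm ?_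
    exact (Measurable.prodMk ham (h.adapted t)).comap_le
  have key := (indepFun_iff_map_prod_eq_prod_map_map hX.aemeasurable hζ.aemeasurable).1 hind
  rw [h.law t] at key
  set f : (ℝ≥0∞ × E) × ℝ → ℝ≥0∞ := fun q => q.1.1 * g (q.1.2, q.2) with hf
  have hfm : Measurable f := by
    refine Measurable.mul (by fun_prop) (hg.comp ?_)
    fun_prop
  have e1 : ∫⁻ q, f q ∂(P.map fun ω => ((a ω, s t ω), ζ t ω))
      = ∫⁻ ω in A, g (s t ω, ζ t ω) ∂P := by
    rw [lintegral_map hfm (hX.prodMk hζ), ← lintegral_indicator hA']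
    refine lintegral_congr fun ω => ?_
    by_cases hω : ω ∈ A <;> simp [hf, ha, hω]
  have hgi : Measurable fun x : E => ∫⁻ z, g (x, z) ∂μ := hg.lintegral_prod_right'
  have e2 : ∫⁻ q, f q ∂((P.map fun ω => (a ω, s t ω)).prod μ)
      = ∫⁻ ω in A, ∫⁻ z, g (s t ω, z) ∂μ ∂P := by
    rw [lintegral_prod _ hfm.aemeasurable, lintegral_map hfm.lintegral_prod_right' hX,
      ← lintegral_indicator hA']
    refine lintegral_congr fun ω => ?_
    by_cases hω : ω ∈ A <;> simp [hf, ha, hω]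
  rw [← e1, ← e2, key]

/-- A consequence of Lévy's zero-one law: if the conditional probability of `C` is bounded below
on each `A t`, then `C` holds almost surely when infinitely many `A t` occur. -/
theorem ae_mem_of_frequently {C : Set Ω} (hC : MeasurableSet[⨆ t, ℱ t] C) {A : ℕ → Set Ω}
    (hA : ∀ t, MeasurableSet[ℱ t] (A t)) {c : ℝ} (hc : 0 < c) (n : ℕ)
    (h : ∀ t, n ≤ t → ∀ B, MeasurableSet[ℱ t] B → B ⊆ A t →
      ENNReal.ofReal c * P B ≤ P (B ∩ C)) :
    ∀ᵐ ω ∂P, (∃ᶠ t in atTop, ω ∈ A t) → ω ∈ C := by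
  have hle : (⨆ t, ℱ t) ≤ mΩ := iSup_le ℱ.le
  have hC' := hle _ hC
  set f : Ω → ℝ := C.indicator 1 with hf
  have hfint : Integrable f P := (integrable_const (1 : ℝ)).indicator hC'
  have hfm : StronglyMeasurable[⨆ t, ℱ t] f := stronglyMeasurable_one.indicator hC
  have hlim := tendsto_ae_condExp (μ := P) (ℱ := ℱ) f
  rw [condExp_of_stronglyMeasurable hle hfm hfint] at hlim
  have hlow : ∀ t, ∀ᵐ ω ∂P, n ≤ t → ω ∈ A t → c ≤ (P[f | ℱ t]) ω := by
    intro t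
    by_cases hnt : n ≤ t
    swap
    · exact Eventually.of_forall fun ω h => absurd h hnt
    set e := P[f | ℱ t] with he
    have hem : Measurable[ℱ t] e := stronglyMeasurable_condExp.measurable
    -- The part of `A t` where the conditional probability falls below `c`. The hypothesis applied
    -- to this very event makes it null.
    set B : Set Ω := A t ∩ {ω | e ω < c} with hB
    have hBm : MeasurableSet[ℱ t] B :=
      (hA t).inter (measurableSet_lt hem measurable_const)
    have hBm' := ℱ.le t _ hBm
    have h1 := h t hnt B hBm inter_subset_left
    have h2 : ∫ ω in B, e ω ∂P = P.real (B ∩ C) := by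
      rw [he, setIntegral_condExp (ℱ.le t) hfint hBm, hf, integral_indicator hC',
        Measure.restrict_restrict hC', inter_comm]
      simp [Measure.real]
    have h3 : c * P.real B ≤ P.real (B ∩ C) := by
      have := ENNReal.toReal_mono (measure_ne_top P _) h1
      rwa [ENNReal.toReal_mul, ENNReal.toReal_ofReal hc.le] at this
    have hint : IntegrableOn (fun ω => c - e ω) B P :=
      ((integrable_const c).sub integrable_condExp).integrableOn
    have h4 : ∫ ω in B, (c - e ω) ∂P ≤ 0 := by
      rw [integral_sub (integrable_const c) integrable_condExp.integrableOn, h2]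
      simp only [setIntegral_const, smul_eq_mul]
      linarith
    have hnn : 0 ≤ᵐ[P.restrict B] fun ω => c - e ω :=
      (ae_restrict_iff' hBm').2 (Eventually.of_forall fun ω hω => by
        have : e ω < c := hω.2
        simp only [Pi.zero_apply]
        linarith)
    have h5 : P B = 0 := by
      by_contra hne
      have : 0 < ∫ ω in B, (c - e ω) ∂P := by
        rw [setIntegral_pos_iff_support_of_nonneg_ae hnn hint]
        refine lt_of_lt_of_le (pos_iff_ne_zero.2 hne) (measure_mono fun ω hω => ⟨?_, hω⟩)
        have : e ω < c := hω.2
        simp only [Function.mem_support]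
        linarith
      linarith
    have h6 : ∀ᵐ ω ∂P, ω ∉ B := measure_eq_zero_iff_ae_notMem.1 h5
    filter_upwards [h6] with ω hω _ hωA
    by_contra hlt
    exact hω ⟨hωA, not_le.1 hlt⟩
  filter_upwards [hlim, ae_all_iff.2 hlow] with ω h1 h2 hfreq
  by_contra hωC
  have h0 : f ω = 0 := by simp [hf, hωC]
  rw [h0] at h1
  have h3 := (h1.eventually (gt_mem_nhds hc)).and (eventually_ge_atTop n)
  obtain ⟨t, hωt, h4, h5⟩ := (hfreq.and_eventually h3).exists
  linarith [h2 t h5 hωt]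

/-- A conditional Borel–Cantelli lemma: each visit to `Q` leads to `Q'` in one step with conditional
probability at least `c`, so the zero-one law applies to the event of a visit to `Q'` after time
`n`, for every `n`. -/
theorem IsChain.frequently_of_frequently (h : IsChain P μ F ℱ s ζ) {Q Q' : Set E}
    (hQ : MeasurableSet Q) (hQ' : MeasurableSet Q') {c : ℝ} (hc : 0 < c)
    (hstep : ∀ e ∈ Q, ENNReal.ofReal c ≤ μ {z | F e z ∈ Q'}) :
    ∀ᵐ ω ∂P, (∃ᶠ t in atTop, s t ω ∈ Q) → ∃ᶠ t in atTop, s t ω ∈ Q' := by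
  have key : ∀ n, ∀ᵐ ω ∂P, (∃ᶠ t in atTop, ω ∈ s t ⁻¹' Q) →
      ω ∈ ⋃ t ≥ n, s t ⁻¹' Q' := by
    intro n
    refine ae_mem_of_frequently (ℱ := ℱ) ?_ (fun t => h.adapted t hQ) hc n ?_
    · refine MeasurableSet.iUnion fun t => MeasurableSet.iUnion fun _ => ?_
      exact le_iSup (fun t => (ℱ t : MeasurableSpace Ω)) t _ (h.adapted t hQ')
    · intro t hnt B hB hBA
      have hm : MeasurableSet {p : E × ℝ | F p.1 p.2 ∈ Q'} := h.measurable_update hQ'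
      have e1 := h.setLIntegral_eq t hB
        (g := {p : E × ℝ | F p.1 p.2 ∈ Q'}.indicator 1) (measurable_one.indicator hm)
      have e2 : ∀ e : E, ∫⁻ z, {p : E × ℝ | F p.1 p.2 ∈ Q'}.indicator 1 (e, z) ∂μ
          = μ {z | F e z ∈ Q'} := by
        intro e
        have : MeasurableSet {z | F e z ∈ Q'} := measurable_prodMk_left hm
        rw [← lintegral_indicator_one this]
        rfl
      have e3 : ∫⁻ ω in B, {p : E × ℝ | F p.1 p.2 ∈ Q'}.indicator 1 (s t ω, ζ t ω) ∂P
          = P (B ∩ s (t + 1) ⁻¹' Q') := by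
        have hm' : MeasurableSet (s (t + 1) ⁻¹' Q') := h.measurable (t + 1) hQ'
        rw [inter_comm, ← Measure.restrict_apply hm', ← lintegral_indicator_one hm']
        refine lintegral_congr fun ω => ?_
        by_cases hω : F (s t ω) (ζ t ω) ∈ Q'
        · rw [indicator_of_mem (show (s t ω, ζ t ω) ∈ {p : E × ℝ | F p.1 p.2 ∈ Q'} from hω),
            indicator_of_mem (by simpa [h.step t ω] using hω)]
          rfl
        · rw [indicator_of_notMem (show (s t ω, ζ t ω) ∉ {p : E × ℝ | F p.1 p.2 ∈ Q'} from hω),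
            indicator_of_notMem (by simpa [h.step t ω] using hω)]
      have hsub : B ∩ s (t + 1) ⁻¹' Q' ⊆ B ∩ ⋃ t ≥ n, s t ⁻¹' Q' :=
        inter_subset_inter_right _
          (subset_iUnion₂ (s := fun t (_ : t ≥ n) => s t ⁻¹' Q') (t + 1) (by omega))
      refine le_trans ?_ (measure_mono hsub)
      rw [← e3, e1, ← setLIntegral_const]
      refine setLIntegral_mono' (ℱ.le t _ hB) fun ω hω => ?_
      rw [e2]
      exact hstep _ (hBA hω)
  filter_upwards [ae_all_iff.2 key] with ω hω hfreq
  rw [frequently_atTop]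
  intro n
  simpa using! hω n hfreq

/-- Up to time `t`, the chain has stayed in `G` since time `T`. -/
def stay (s : ℕ → Ω → E) (G : Set E) (T t : ℕ) : Set Ω := {ω | ∀ i, T ≤ i → i ≤ t → s i ω ∈ G}

theorem IsChain.measurableSet_stay (h : IsChain P μ F ℱ s ζ) {G : Set E}
    (hG : MeasurableSet G) (T t : ℕ) : MeasurableSet[ℱ t] (stay s G T t) := by
  have : stay s G T t = ⋂ i, ⋂ _ : T ≤ i, ⋂ _ : i ≤ t, s i ⁻¹' G := by
    ext ω; simp [stay]
  rw [this]
  refine MeasurableSet.iInter fun i => MeasurableSet.iInter fun _ => MeasurableSet.iInter fun hi => ?_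
  exact ℱ.mono hi _ (h.adapted i hG)

/-- Foster–Lyapunov estimate. -/
theorem IsChain.tsum_setLIntegral_le (h : IsChain P μ F ℱ s ζ) {G : Set E}
    (hG : MeasurableSet G) {V : E → ℝ≥0∞} (hV : Measurable V) {g : E × ℝ → ℝ≥0∞}
    (hg : Measurable g) (hdrift : ∀ e ∈ G, ∫⁻ z, (V (F e z) + g (e, z)) ∂μ ≤ V e)
    {T : ℕ} {A : Set Ω} (hA : MeasurableSet[ℱ T] A) :
    ∑' k, ∫⁻ ω in A ∩ stay s G T (T + k), g (s (T + k) ω, ζ (T + k) ω) ∂P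
      ≤ ∫⁻ ω in A, V (s T ω) ∂P := by
  have hS : ∀ k, MeasurableSet[ℱ (T + k)] (A ∩ stay s G T (T + k)) := fun k =>
    (ℱ.mono (Nat.le_add_right T k) _ hA).inter (h.measurableSet_stay hG T (T + k))
  have hmono : ∀ k, A ∩ stay s G T (T + (k + 1)) ⊆ A ∩ stay s G T (T + k) := fun k =>
    inter_subset_inter_right _ fun ω hω i h1 h2 => hω i h1 (by omega)
  have hVF : Measurable fun p : E × ℝ => V (F p.1 p.2) := hV.comp h.measurable_update
  have hstep : ∀ k,
      ∫⁻ ω in A ∩ stay s G T (T + (k + 1)), V (s (T + (k + 1)) ω) ∂P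
        + ∫⁻ ω in A ∩ stay s G T (T + k), g (s (T + k) ω, ζ (T + k) ω) ∂P
      ≤ ∫⁻ ω in A ∩ stay s G T (T + k), V (s (T + k) ω) ∂P := by
    intro k
    have e1 := h.setLIntegral_eq (T + k) (hS k) (g := fun p => V (F p.1 p.2) + g p)
      (hVF.add hg)
    have hm1 : Measurable fun ω => V (s (T + (k + 1)) ω) := hV.comp (h.measurable _)
    calc _ ≤ ∫⁻ ω in A ∩ stay s G T (T + k), V (s (T + (k + 1)) ω) ∂P
        + ∫⁻ ω in A ∩ stay s G T (T + k), g (s (T + k) ω, ζ (T + k) ω) ∂P := by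
          gcongr ?_ + _
          exact lintegral_mono_set (hmono k)
      _ = ∫⁻ ω in A ∩ stay s G T (T + k),
            (V (F (s (T + k) ω) (ζ (T + k) ω)) + g (s (T + k) ω, ζ (T + k) ω)) ∂P := by
          rw [← lintegral_add_left hm1]
          refine lintegral_congr fun ω => ?_
          rw [← h.step, Nat.add_assoc]
      _ = _ := e1
      _ ≤ _ := setLIntegral_mono' (ℱ.le _ _ (hS k)) fun ω hω =>
          hdrift _ (hω.2 _ (by omega) le_rfl)
  have hsum : ∀ N, ∑ k ∈ Finset.range N,
        ∫⁻ ω in A ∩ stay s G T (T + k), g (s (T + k) ω, ζ (T + k) ω) ∂P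
      + ∫⁻ ω in A ∩ stay s G T (T + N), V (s (T + N) ω) ∂P
      ≤ ∫⁻ ω in A, V (s T ω) ∂P := by
    intro N
    induction N with
    | zero => simpa using lintegral_mono_set (μ := P) inter_subset_left
    | succ N ih =>
      refine le_trans ?_ ih
      rw [Finset.sum_range_succ, add_assoc]
      gcongr
      rw [add_comm]
      exact hstep N
  rw [ENNReal.tsum_eq_iSup_nat]
  exact iSup_le fun N => le_trans le_self_add (hsum N)

/-- The Foster–Lyapunov estimate as a bound on the mean total dissipation before leaving `G`, ready
for finiteness or for Markov's inequality. -/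
theorem IsChain.setLIntegral_tsum_le (h : IsChain P μ F ℱ s ζ) {G : Set E}
    (hG : MeasurableSet G) {V : E → ℝ≥0∞} (hV : Measurable V) {g : E × ℝ → ℝ≥0∞}
    (hg : Measurable g) (hdrift : ∀ e ∈ G, ∫⁻ z, (V (F e z) + g (e, z)) ∂μ ≤ V e)
    {T : ℕ} {A : Set Ω} (hA : MeasurableSet[ℱ T] A) :
    ∫⁻ ω in A, ∑' k, (stay s G T (T + k)).indicator
        (fun ω => g (s (T + k) ω, ζ (T + k) ω)) ω ∂P
      ≤ ∫⁻ ω in A, V (s T ω) ∂P := by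
  have hm : ∀ k, Measurable fun ω => g (s (T + k) ω, ζ (T + k) ω) := fun k =>
    hg.comp ((h.measurable _).prodMk (h.measurable_noise _))
  have hS : ∀ k, MeasurableSet (stay s G T (T + k)) := fun k =>
    ℱ.le _ _ (h.measurableSet_stay hG T (T + k))
  rw [lintegral_tsum fun k => ((hm k).indicator (hS k)).aemeasurable]
  refine le_trans (le_of_eq ?_) (h.tsum_setLIntegral_le hG hV hg hdrift hA)
  refine tsum_congr fun k => ?_
  rw [lintegral_indicator (hS k), Measure.restrict_restrict (hS k), inter_comm]

/-- If a Lyapunov function decreases on `G`, then the dissipation is summable along every path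
which is eventually in `G`. -/
theorem IsChain.ae_tsum_lt_top (h : IsChain P μ F ℱ s ζ) {G : Set E}
    (hG : MeasurableSet G) {V : E → ℝ≥0∞} (hV : Measurable V) (hVfin : ∀ e, V e ≠ ∞)
    {g : E × ℝ → ℝ≥0∞} (hg : Measurable g)
    (hdrift : ∀ e ∈ G, ∫⁻ z, (V (F e z) + g (e, z)) ∂μ ≤ V e) :
    ∀ᵐ ω ∂P, ∀ T, (∀ t, T ≤ t → s t ω ∈ G) → ∑' k, g (s (T + k) ω, ζ (T + k) ω) < ∞ := by
  rw [ae_all_iff]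
  intro T
  -- The initial value of `V` need not be integrable, so the estimate is localized to the events `V
  -- ≤ K`.
  have key : ∀ K : ℕ, ∀ᵐ ω ∂P, V (s T ω) ≤ K → ∑' k, (stay s G T (T + k)).indicator
        (fun ω => g (s (T + k) ω, ζ (T + k) ω)) ω < ∞ := by
    intro K
    have hA : MeasurableSet[ℱ T] {ω | V (s T ω) ≤ K} :=
      measurableSet_le (hV.comp (h.adapted T)) measurable_const
    have h1 := h.setLIntegral_tsum_le hG hV hg hdrift hA
    have h2 : ∫⁻ ω in {ω | V (s T ω) ≤ K}, V (s T ω) ∂P < ∞ := by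
      refine lt_of_le_of_lt (setLIntegral_mono' (g := fun _ => (K : ℝ≥0∞)) (ℱ.le _ _ hA)
        fun ω hω => hω) ?_
      rw [setLIntegral_const]
      exact ENNReal.mul_lt_top (by simp) (measure_lt_top _ _)
    have hm : Measurable fun ω => ∑' k, (stay s G T (T + k)).indicator
        (fun ω => g (s (T + k) ω, ζ (T + k) ω)) ω := by
      refine Measurable.tsum fun k => Measurable.indicator
        (hg.comp ((h.measurable _).prodMk (h.measurable_noise _)))
        (ℱ.le _ _ (h.measurableSet_stay hG T (T + k)))
    exact (ae_restrict_iff' (ℱ.le _ _ hA)).1 (ae_lt_top hm (h1.trans_lt h2).ne)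
  filter_upwards [ae_all_iff.2 key] with ω hω hG'
  obtain ⟨K, hK⟩ := ENNReal.exists_nat_gt (hVfin (s T ω))
  have := hω K hK.le
  refine lt_of_le_of_lt (le_of_eq (tsum_congr fun k => ?_)) this
  exact (indicator_of_mem (show ω ∈ stay s G T (T + k) from fun i hi _ => hG' i hi)
    (fun ω => g (s (T + k) ω, ζ (T + k) ω))).symm

end Chain

/-! ### The update map -/

section Update

/-- The step size after the consecutive measurements `y`, `y'`. -/
noncomputable def newStep (u d gbar γ y y' : ℝ) : ℝ :=
  if 0 < y * y' then min (u * γ) gbar else d * γ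

/-- One iteration of the algorithm on states (iterate, step size, last measurement). -/
noncomputable def update (φ : ℝ → ℝ) (u d gbar : ℝ) (e : ℝ × ℝ × ℝ) (z : ℝ) : ℝ × ℝ × ℝ :=
  (e.1 - e.2.1 * (φ e.1 + z), newStep u d gbar e.2.1 e.2.2 (φ e.1 + z), φ e.1 + z)

theorem measurable_update {φ : ℝ → ℝ} (hφ : Measurable φ) (u d gbar : ℝ) :
    Measurable (fun p : (ℝ × ℝ × ℝ) × ℝ => update φ u d gbar p.1 p.2) := by
  have hy : Measurable fun p : (ℝ × ℝ × ℝ) × ℝ => φ p.1.1 + p.2 :=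
    (hφ.comp (by fun_prop)).add (by fun_prop)
  refine Measurable.prodMk (by fun_prop) (Measurable.prodMk ?_ hy)
  refine Measurable.ite (measurableSet_lt measurable_const ?_) ?_ ?_ <;> fun_prop

theorem newStep_mem {u d gbar γ y y' : ℝ} (hu : 1 < u) (hd : 0 < d) (hd' : d < 1)
    (hγ : γ ∈ Ioc 0 gbar) : newStep u d gbar γ y y' ∈ Ioc 0 gbar := by
  obtain ⟨h0, h1⟩ := hγ
  unfold newStep
  split_ifs
  · exact ⟨lt_min (by positivity) (h0.trans_le h1), min_le_right _ _⟩
  · exact ⟨by positivity, by nlinarith⟩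

theorem newStep_le {u d gbar γ y y' : ℝ} (hu : 1 < u) (hd' : d < 1)
    (hγ : 0 < γ) : newStep u d gbar γ y y' ≤ u * γ := by
  unfold newStep
  split_ifs
  · exact min_le_left _ _
  · nlinarith

end Update

/-! ### A run of the algorithm as a Markov chain -/

section Run

variable {Ω : Type*} [mΩ : MeasurableSpace Ω] {φ : ℝ → ℝ} {u d gbar : ℝ} {x γ y ξ : ℕ → Ω → ℝ}

theorem IsRun.stepSize_eq (h : IsRun φ u d gbar x γ y ξ) (t : ℕ) (ω : Ω) :
    γ (t + 2) ω = newStep u d gbar (γ (t + 1) ω) (y (t + 1) ω) (y (t + 2) ω) := by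
  unfold newStep
  split_ifs with h0
  · exact h.stepSize_same t ω h0
  · exact h.stepSize_change t ω (not_lt.1 h0)

theorem IsRun.stepSize_mem (h : IsRun φ u d gbar x γ y ξ) (hu : 1 < u) (hd : 0 < d) (hd' : d < 1)
    (t : ℕ) (ω : Ω) : γ (t + 1) ω ∈ Ioc 0 gbar := by
  induction t with
  | zero => exact h.γ_one_mem ω
  | succ t ih => rw [h.stepSize_eq]; exact newStep_mem hu hd hd' ih

theorem IsRun.state_succ (h : IsRun φ u d gbar x γ y ξ) (t : ℕ) (ω : Ω) :
    (x (t + 2) ω, γ (t + 2) ω, y (t + 2) ω)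
      = update φ u d gbar (x (t + 1) ω, γ (t + 1) ω, y (t + 1) ω) (ξ (t + 2) ω) := by
  simp only [update]
  rw [← h.measurement (t + 1) ω, ← h.step (t + 1) ω, h.stepSize_eq]

theorem IsRun.measurable (h : IsRun φ u d gbar x γ y ξ) (hφ : Measurable φ) (t : ℕ) :
    Measurable (x t) ∧ Measurable (γ t) ∧ Measurable (γ (t + 1)) ∧ Measurable (y (t + 1)) := by
  have hy : ∀ t, Measurable (x t) → Measurable (y (t + 1)) := fun t ht => by
    have : y (t + 1) = fun ω => φ (x t ω) + ξ (t + 1) ω := funext (h.measurement t)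
    rw [this]
    exact (hφ.comp ht).add (h.measurable_noise _)
  induction t with
  | zero => exact ⟨h.measurable_x_zero, h.measurable_γ_zero, h.measurable_γ_one,
      hy 0 h.measurable_x_zero⟩
  | succ t ih =>
    obtain ⟨h1, h2, h3, h4⟩ := ih
    have hx : Measurable (x (t + 1)) := by
      have : x (t + 1) = fun ω => x t ω - γ t ω * y (t + 1) ω := funext (h.step t)
      rw [this]
      exact h1.sub (h2.mul h4)
    refine ⟨hx, h3, ?_, hy _ hx⟩
    have : γ (t + 1 + 1) = fun ω =>
        newStep u d gbar (γ (t + 1) ω) (y (t + 1) ω) (y (t + 2) ω) := funext (h.stepSize_eq t)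
    rw [this]
    have h5 := hy _ hx
    refine Measurable.ite (measurableSet_lt measurable_const (h4.mul h5)) ?_ ?_ <;> fun_prop

/-- The filtration of the histories, from time `1` on. -/
def historyFiltration (h : IsRun φ u d gbar x γ y ξ) (hφ : Measurable φ) : Filtration ℕ mΩ where
  seq t := history x γ ξ (t + 1)
  mono' := fun i j hij => iSup_mono fun k => iSup_mono' fun hk => ⟨by omega, le_rfl⟩
  le' := fun i => iSup_le fun k => iSup_le fun _ => sup_le (sup_le
    (h.measurable hφ k).1.comap_le (h.measurable hφ k).2.1.comap_le) (h.measurable_noise k).comap_le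

/-- The chain starts at time 1: `γ 0` and `γ 1` are free, and the step size rule needs a previous
measurement. Thus its noise at index `t` is `ξ (t + 2)`. -/
theorem IsRun.isChain (h : IsRun φ u d gbar x γ y ξ) (hφ : Measurable φ)
    {P : Measure Ω} {μ : Measure ℝ} (hn : NoiseCondition P μ x γ ξ) :
    IsChain P μ (update φ u d gbar) (historyFiltration h hφ)
      (fun t ω => (x (t + 1) ω, γ (t + 1) ω, y (t + 1) ω)) (fun t => ξ (t + 2)) where
  measurable_update := measurable_update hφ u d gbar
  adapted := by
    intro t
    have hle : ∀ i ≤ t + 1, MeasurableSpace.comap (x i) inferInstance ⊔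
        MeasurableSpace.comap (γ i) inferInstance ⊔ MeasurableSpace.comap (ξ i) inferInstance
        ≤ historyFiltration h hφ t := fun i hi =>
      le_iSup₂ (f := fun (i : ℕ) (_ : i ≤ t + 1) => MeasurableSpace.comap (x i) inferInstance ⊔
        MeasurableSpace.comap (γ i) inferInstance ⊔ MeasurableSpace.comap (ξ i) inferInstance) i hi
    have hx : ∀ i ≤ t + 1, Measurable[historyFiltration h hφ t] (x i) := fun i hi =>
      Measurable.of_comap_le ((le_sup_left.trans le_sup_left).trans (hle i hi))
    have hγ : ∀ i ≤ t + 1, Measurable[historyFiltration h hφ t] (γ i) := fun i hi =>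
      Measurable.of_comap_le ((le_sup_right.trans le_sup_left).trans (hle i hi))
    have hξ : ∀ i ≤ t + 1, Measurable[historyFiltration h hφ t] (ξ i) := fun i hi =>
      Measurable.of_comap_le (le_sup_right.trans (hle i hi))
    refine Measurable.prodMk (hx _ le_rfl) (Measurable.prodMk (hγ _ le_rfl) ?_)
    have : y (t + 1) = fun ω => φ (x t ω) + ξ (t + 1) ω := funext (h.measurement t)
    rw [this]
    exact (hφ.comp (hx t (by omega))).add (hξ _ le_rfl)
  measurable_noise := fun t => h.measurable_noise _
  indep := fun t => (hn (t + 1)).1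
  law := fun t => (hn (t + 1)).2
  step := fun t ω => h.state_succ t ω

end Run

/-! ### Regularity of the noise law -/

section Noise

variable {μ : Measure ℝ} [IsProbabilityMeasure μ]

/-- Dominated convergence: the indicator of `Iio a` at `z` is continuous in `a` at `b` unless `z =
b`, a null event. -/
theorem continuous_measureReal_Iio (hatoms : ∀ z : ℝ, μ {z} = 0) :
    Continuous fun a => μ.real (Iio a) := by
  have e : (fun a => μ.real (Iio a)) = fun a => ∫ z, (Iio a).indicator (1 : ℝ → ℝ) z ∂μ := by
    funext a
    rw [integral_indicator_one measurableSet_Iio]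
  rw [e]
  refine continuous_iff_continuousAt.2 fun b => ?_
  refine continuousAt_of_dominated (bound := fun _ => 1) ?_ ?_ (integrable_const _) ?_
  · exact Eventually.of_forall fun a =>
      (measurable_one.indicator measurableSet_Iio).aestronglyMeasurable
  · refine Eventually.of_forall fun a => Eventually.of_forall fun z => ?_
    by_cases hz : z ∈ Iio a <;> simp [hz]
  · filter_upwards [measure_eq_zero_iff_ae_notMem.1 (hatoms b)] with z hz
    rcases lt_or_gt_of_ne (show z ≠ b from hz) with h | h
    · refine (continuousAt_const (y := (1 : ℝ))).congr ?_
      filter_upwards [lt_mem_nhds h] with a ha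
      exact (indicator_of_mem (show z ∈ Iio a from ha) (1 : ℝ → ℝ)).symm
    · refine (continuousAt_const (y := (0 : ℝ))).congr ?_
      filter_upwards [gt_mem_nhds h] with a ha
      exact (indicator_of_notMem (show z ∉ Iio a from not_lt.2 ha.le) (1 : ℝ → ℝ)).symm

theorem measureReal_Ioi_eq (hatoms : ∀ z : ℝ, μ {z} = 0) (a : ℝ) :
    μ.real (Ioi a) = 1 - μ.real (Iio a) := by
  have : NullSingletonClass μ := ⟨hatoms⟩
  have h1 : μ.real (Iic a)ᶜ = 1 - μ.real (Iic a) := by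
    rw [measureReal_compl measurableSet_Iic]; simp
  rw [compl_Iic] at h1
  rw [h1, measureReal_congr Iio_ae_eq_Iic]

/-- Noise intervals of a given length near the origin have probabilities bounded below. -/
theorem exists_forall_le_measure_Ioo (hatoms : ∀ z : ℝ, μ {z} = 0) {L : ℝ}
    (hL : ∀ a b : ℝ, -L ≤ a → a < b → b ≤ L → 0 < μ (Ioo a b)) {ε : ℝ} (hε : 0 < ε) :
    ∃ c : ℝ, 0 < c ∧ ∀ a, -L ≤ a → a + ε ≤ L → ENNReal.ofReal c ≤ μ (Ioo a (a + ε)) := by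
  have : NullSingletonClass μ := ⟨hatoms⟩
  have hF := continuous_measureReal_Iio hatoms
  have hIoo : ∀ a, μ.real (Ioo a (a + ε)) = μ.real (Iio (a + ε)) - μ.real (Iio a) := by
    intro a
    have h1 : Iio (a + ε) = Iio a ∪ Ico a (a + ε) := (Iio_union_Ico_eq_Iio (by linarith)).symm
    have h2 : Disjoint (Iio a) (Ico a (a + ε)) :=
      Set.disjoint_left.2 fun z h1 h2 => not_lt.2 h2.1 h1
    have h3 : μ.real (Ioo a (a + ε)) = μ.real (Ico a (a + ε)) := measureReal_congr Ioo_ae_eq_Ico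
    rw [h1, measureReal_union h2 measurableSet_Ico, h3]
    ring
  -- The mass of `Ioo a (a + ε)` is continuous and positive in `a` on a compact interval, so its
  -- minimum is the required bound.
  rcases (Icc (-L) (L - ε)).eq_empty_or_nonempty with he | hne
  · refine ⟨1, one_pos, fun a h1 h2 => ?_⟩
    have : a ∈ Icc (-L) (L - ε) := ⟨h1, by linarith⟩
    simp [he] at this
  · obtain ⟨a0, ha0, hmin⟩ := isCompact_Icc.exists_isMinOn hne
      (f := fun a => μ.real (Iio (a + ε)) - μ.real (Iio a))
      ((hF.comp (continuous_id.add continuous_const)).sub hF).continuousOn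
    refine ⟨μ.real (Ioo a0 (a0 + ε)), ?_, fun a h1 h2 => ?_⟩
    · exact ENNReal.toReal_pos (hL _ _ ha0.1 (by linarith) (by linarith [ha0.2])).ne'
        (measure_ne_top _ _)
    · have h3 := isMinOn_iff.1 hmin a ⟨h1, by linarith⟩
      rw [ENNReal.ofReal_le_iff_le_toReal (measure_ne_top _ _)]
      change _ ≤ μ.real _
      rw [hIoo, hIoo]
      exact h3

end Noise

/-! ### The potential, an antiderivative of φ -/

section Smooth

variable {φ : ℝ → ℝ}

theorem SmoothBounded.abs_sub_le (h : SmoothBounded φ) (a b : ℝ) :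
    |φ a - φ b| ≤ derivSup φ * |a - b| := by
  have hd : ∀ x ∈ (univ : Set ℝ), DifferentiableAt ℝ φ x := fun x _ =>
    (h.1.differentiable (by norm_num)) x
  have hb : ∀ x ∈ (univ : Set ℝ), ‖deriv φ x‖ ≤ derivSup φ := fun x _ =>
    le_ciSup h.2 x
  simpa using convex_univ.norm_image_sub_le_of_norm_deriv_le hd hb (mem_univ b) (mem_univ a)

/-- The antiderivative of `φ` vanishing at `0`. -/
noncomputable def potential (φ : ℝ → ℝ) (x : ℝ) : ℝ := ∫ t in (0 : ℝ)..x, φ t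

theorem hasDerivAt_potential (h : Continuous φ) (x : ℝ) : HasDerivAt (potential φ) (φ x) x :=
  intervalIntegral.integral_hasDerivAt_right (h.intervalIntegrable _ _)
    (h.stronglyMeasurableAtFilter _ _) h.continuousAt

theorem continuous_potential (h : Continuous φ) : Continuous (potential φ) :=
  continuous_iff_continuousAt.2 fun x => (hasDerivAt_potential h x).continuousAt

/-- The descent lemma for a gradient with Lipschitz constant `derivSup φ`: the difference of the two
sides, as a function of `k`, vanishes at 0 and its derivative has the sign of `k`. -/
theorem SmoothBounded.potential_add_le (h : SmoothBounded φ) (x k : ℝ) :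
    potential φ (x + k) ≤ potential φ x + φ x * k + derivSup φ / 2 * k ^ 2 := by
  set M := derivSup φ
  have hc : Continuous φ := h.1.continuous
  set f : ℝ → ℝ := fun s => potential φ x + φ x * s + M / 2 * s ^ 2 - potential φ (x + s) with hf
  have hder : ∀ s, HasDerivAt f (φ x + M * s - φ (x + s)) s := by
    intro s
    have h1 : HasDerivAt (fun s => potential φ (x + s)) (φ (x + s)) s := by
      simpa using (hasDerivAt_potential hc (x + s)).comp_const_add x s
    have h2 : HasDerivAt (fun s : ℝ => potential φ x + φ x * s + M / 2 * s ^ 2)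
        (φ x + M * s) s := by
      have := (((hasDerivAt_id s).const_mul (φ x)).const_add (potential φ x)).add
        (((hasDerivAt_id s).pow 2).const_mul (M / 2))
      refine this.congr_deriv ?_
      simp; ring
    exact h2.sub h1
  have hfc : Continuous f := continuous_iff_continuousAt.2 fun s => (hder s).continuousAt
  have hlip : ∀ s, |φ (x + s) - φ x| ≤ M * |s| := fun s => by
    simpa using h.abs_sub_le (x + s) x
  have h0 : f 0 = 0 := by simp [hf]
  have : 0 ≤ f k := by
    rcases le_total 0 k with hk | hk
    · have hm : MonotoneOn f (Ici 0) := by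
        refine monotoneOn_of_deriv_nonneg (convex_Ici 0) hfc.continuousOn
          (fun s _ => (hder s).differentiableAt.differentiableWithinAt) fun s hs => ?_
        rw [interior_Ici] at hs
        rw [(hder s).deriv]
        have := hlip s
        rw [abs_of_pos (show 0 < s from hs)] at this
        linarith [(abs_le.1 this).2]
      simpa [h0] using hm self_mem_Ici hk hk
    · have hm : AntitoneOn f (Iic 0) := by
        refine antitoneOn_of_deriv_nonpos (convex_Iic 0) hfc.continuousOn
          (fun s _ => (hder s).differentiableAt.differentiableWithinAt) fun s hs => ?_
        rw [interior_Iic] at hs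
        rw [(hder s).deriv]
        have := hlip s
        rw [abs_of_neg (show s < 0 from hs)] at this
        linarith [(abs_le.1 this).1]
      simpa [h0] using hm hk self_mem_Iic hk
  simp only [hf] at this
  linarith

/-- The potential is bounded below when `φ` has the sign of `x` far from the origin. -/
theorem exists_forall_le_potential (h : Continuous φ) {R : ℝ} (hR : 0 < R)
    (hsign : ∀ x : ℝ, R ≤ |x| → 0 < x * φ x) : ∃ m, ∀ x, m ≤ potential φ x := by
  have hc := continuous_potential h
  obtain ⟨x0, -, hmin⟩ := (isCompact_Icc (a := -R) (b := R)).exists_isMinOn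
    ⟨0, by constructor <;> linarith⟩ hc.continuousOn
  refine ⟨potential φ x0, fun x => ?_⟩
  have hmin' : ∀ z ∈ Icc (-R) R, potential φ x0 ≤ potential φ z := isMinOn_iff.1 hmin
  rcases le_total x (-R) with h1 | h1
  · have hm : AntitoneOn (potential φ) (Iic (-R)) := by
      refine antitoneOn_of_deriv_nonpos (convex_Iic _) hc.continuousOn
        (fun s _ => (hasDerivAt_potential h s).differentiableAt.differentiableWithinAt)
        fun s hs => ?_
      rw [interior_Iic] at hs
      rw [(hasDerivAt_potential h s).deriv]
      have hs' : s < -R := hs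
      have := hsign s (by rw [abs_of_neg (by linarith)]; linarith)
      nlinarith
    exact (hmin' (-R) (by constructor <;> linarith)).trans (hm h1 self_mem_Iic h1)
  rcases le_total R x with h2 | h2
  · have hm : MonotoneOn (potential φ) (Ici R) := by
      refine monotoneOn_of_deriv_nonneg (convex_Ici _) hc.continuousOn
        (fun s _ => (hasDerivAt_potential h s).differentiableAt.differentiableWithinAt)
        fun s hs => ?_
      rw [interior_Ici] at hs
      rw [(hasDerivAt_potential h s).deriv]
      have hs' : R < s := hs
      have := hsign s (by rw [abs_of_pos (by linarith)]; linarith)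
      nlinarith
    exact (hmin' R (by constructor <;> linarith)).trans (hm self_mem_Ici h2 h2)
  exact hmin' x ⟨h1, h2⟩

end Smooth

/-! ### Sign probabilities and the limit sets -/

section SignProbabilities

variable {φ : ℝ → ℝ} {μ : Measure ℝ}

/-- The probability that the measurement at `x` is positive. -/
noncomputable def upProb (φ : ℝ → ℝ) (μ : Measure ℝ) (x : ℝ) : ℝ := μ.real (Ioi (-φ x))

/-- The probability that the measurement at `x` is negative. -/
noncomputable def downProb (φ : ℝ → ℝ) (μ : Measure ℝ) (x : ℝ) : ℝ := μ.real (Iio (-φ x))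

/-- The points where the mean logarithmic growth of small step sizes is nonpositive, as a set
depending on `a = log u / -log d`. -/
def limitSet (φ : ℝ → ℝ) (μ : Measure ℝ) (a : ℝ) : Set ℝ :=
  {x | a * (upProb φ μ x ^ 2 + downProb φ μ x ^ 2) ≤ 2 * upProb φ μ x * downProb φ μ x}

theorem mem_limitSet {a x : ℝ} : x ∈ limitSet φ μ a ↔
    a * (upProb φ μ x ^ 2 + downProb φ μ x ^ 2) ≤ 2 * upProb φ μ x * downProb φ μ x := Iff.rfl

theorem upProb_nonneg (x : ℝ) : 0 ≤ upProb φ μ x := measureReal_nonneg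

theorem downProb_nonneg (x : ℝ) : 0 ≤ downProb φ μ x := measureReal_nonneg

theorem limitSet_anti {a b : ℝ} (hab : a ≤ b) : limitSet φ μ b ⊆ limitSet φ μ a := by
  intro x hx
  rw [mem_limitSet] at hx ⊢
  refine le_trans ?_ hx
  gcongr

theorem zeroSet_subset_limitSet (hpos : μ (Ioi 0) = 1 / 2) (hneg : μ (Iio 0) = 1 / 2) {a : ℝ}
    (ha : a < 1) : zeroSet φ ⊆ limitSet φ μ a := by
  intro x hx
  have h0 : φ x = 0 := hx
  simp only [mem_limitSet, upProb, downProb, h0, neg_zero, Measure.real, hpos, hneg]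
  norm_num
  linarith

variable [IsProbabilityMeasure μ]

theorem upProb_add_downProb (hatoms : ∀ z : ℝ, μ {z} = 0) (x : ℝ) :
    upProb φ μ x + downProb φ μ x = 1 := by
  rw [upProb, downProb, measureReal_Ioi_eq hatoms]; ring

theorem continuous_downProb (hφ : Continuous φ) (hatoms : ∀ z : ℝ, μ {z} = 0) :
    Continuous (downProb φ μ) :=
  (continuous_measureReal_Iio hatoms).comp hφ.neg

theorem continuous_upProb (hφ : Continuous φ) (hatoms : ∀ z : ℝ, μ {z} = 0) :
    Continuous (upProb φ μ) := by
  have : upProb φ μ = fun x => 1 - downProb φ μ x := by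
    funext x; linarith [upProb_add_downProb (φ := φ) hatoms x]
  rw [this]
  exact continuous_const.sub (continuous_downProb hφ hatoms)

/-- With threshold `b = -φ x`, the interval next to 0 gives the excess over 1/2 of the probability
of a positive measurement where φ is large. -/
theorem half_add_le_measureReal_Ioi {a b : ℝ} (ha : 0 < a) (h : b ≤ -a)
    (hpos : μ (Ioi 0) = 1 / 2) : 1 / 2 + μ.real (Ioo (-a) 0) ≤ μ.real (Ioi b) := by
  have h1 : μ.real (Ioi 0) = 1 / 2 := by simp [Measure.real, hpos]
  have h2 : Disjoint (Ioo (-a) 0) (Ioi 0) :=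
    Set.disjoint_left.2 fun z h1 h2 => lt_asymm h1.2 h2
  rw [← h1, add_comm, ← measureReal_union h2 measurableSet_Ioi]
  refine measureReal_mono fun z hz => ?_
  rcases hz with hz | hz
  · exact h.trans_lt hz.1
  · have h2 : (0 : ℝ) < z := hz
    exact show b < z by linarith

theorem half_add_le_measureReal_Iio {a b : ℝ} (ha : 0 < a) (h : a ≤ b)
    (hneg : μ (Iio 0) = 1 / 2) : 1 / 2 + μ.real (Ioo 0 a) ≤ μ.real (Iio b) := by
  have h1 : μ.real (Iio 0) = 1 / 2 := by simp [Measure.real, hneg]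
  have h2 : Disjoint (Ioo 0 a) (Iio 0) :=
    Set.disjoint_left.2 fun z h1 h2 => lt_asymm h1.1 h2
  rw [← h1, add_comm, ← measureReal_union h2 measurableSet_Iio]
  refine measureReal_mono fun z hz => ?_
  rcases hz with hz | hz
  · exact hz.2.trans_le h
  · have h2 : z < (0 : ℝ) := hz
    exact show z < b by linarith

/-- Put v = (p - q)². Since p + q = 1, membership reads a(1 + v) ≤ 1 - v, while v ≥ 4m². -/
theorem notMem_limitSet_of_half_add_le {x m a : ℝ} (hatoms : ∀ z : ℝ, μ {z} = 0) (hm : 0 < m)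
    (ha0 : 0 < a) (ha : 1 - 4 * m ^ 2 < a)
    (h : 1 / 2 + m ≤ upProb φ μ x ∨ 1 / 2 + m ≤ downProb φ μ x) : x ∉ limitSet φ μ a := by
  rw [mem_limitSet, not_le]
  have hs := upProb_add_downProb (φ := φ) hatoms x
  have h1 := upProb_nonneg (φ := φ) (μ := μ) x
  have h2 := downProb_nonneg (φ := φ) (μ := μ) x
  set p := upProb φ μ x
  set q := downProb φ μ x
  have hq : q = 1 - p := by linarith
  have hv : 4 * m ^ 2 ≤ (p - q) ^ 2 := by
    rcases h with h | h <;> nlinarith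
  have e1 : p ^ 2 + q ^ 2 = (1 + (p - q) ^ 2) / 2 := by rw [hq]; ring
  have e2 : 2 * p * q = (1 - (p - q) ^ 2) / 2 := by rw [hq]; ring
  rw [e1, e2]
  nlinarith [mul_nonneg ha0.le (sq_nonneg (p - q))]

/-- At distance at least ε from the zeros, |φ| is bounded below: by compactness on `[-R, R]`, by the
tail bound elsewhere. The sign probabilities are then uniformly away from 1/2, which excludes the
point from the limit set for `a` near 1. -/
theorem tendsto_deviation_limitSet (hφ : Continuous φ) (hatoms : ∀ z : ℝ, μ {z} = 0)
    (hpos : μ (Ioi 0) = 1 / 2) (hneg : μ (Iio 0) = 1 / 2) {L : ℝ} (hL0 : 0 < L)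
    (hL : ∀ a b : ℝ, -L ≤ a → a < b → b ≤ L → 0 < μ (Ioo a b)) {R c : ℝ} (hc : 0 < c)
    (htail : ∀ x, R ≤ |x| → c ≤ |φ x|) :
    Tendsto (fun a => deviation (limitSet φ μ a) (zeroSet φ)) (𝓝[<] 1) (𝓝 0) := by
  rw [ENNReal.tendsto_nhds_zero]
  intro ε hε
  rcases eq_or_ne ε ∞ with rfl | hε'
  · exact Eventually.of_forall fun _ => le_top
  lift ε to NNReal using hε'
  have hε0 : (0 : ℝ) < ε := by exact_mod_cast hε
  set S : Set ℝ := Icc (-R) R ∩ ⋂ z ∈ zeroSet φ, {x | (ε : ℝ) ≤ |x - z|} with hS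
  have hScomp : IsCompact S := by
    refine isCompact_Icc.inter_right (isClosed_biInter fun z _ => ?_)
    exact isClosed_le continuous_const (by fun_prop)
  obtain ⟨c', hc', hlow⟩ : ∃ c' > 0, ∀ x ∈ S, c' ≤ |φ x| := by
    rcases S.eq_empty_or_nonempty with he | hne
    · exact ⟨1, one_pos, by simp [he]⟩
    · obtain ⟨x0, hx0, hmin⟩ := hScomp.exists_isMinOn hne hφ.abs.continuousOn
      refine ⟨|φ x0|, abs_pos.2 fun h0 => ?_, isMinOn_iff.1 hmin⟩
      have h1 : (ε : ℝ) ≤ |x0 - x0| := mem_iInter₂.1 hx0.2 x0 h0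
      simp at h1
      linarith
  -- The cut at `L` puts the intervals of length `c0` on both sides of 0 where the noise law has
  -- positive mass.
  set c0 := min (min c c') L with hc0
  have hc0pos : 0 < c0 := lt_min (lt_min hc hc') hL0
  have hfar : ∀ x, (∀ z ∈ zeroSet φ, (ε : ℝ) ≤ |x - z|) → c0 ≤ |φ x| := by
    intro x hx
    rcases le_total R |x| with h | h
    · exact ((min_le_left _ _).trans (min_le_left _ _)).trans (htail x h)
    · refine ((min_le_left _ _).trans (min_le_right _ _)).trans (hlow x ⟨abs_le.1 h, ?_⟩)
      exact mem_iInter₂.2 hx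
  have hm1 : 0 < μ.real (Ioo (-c0) 0) :=
    ENNReal.toReal_pos (hL _ _ (by linarith [min_le_right (min c c') L]) (by linarith) hL0.le).ne'
      (measure_ne_top _ _)
  have hm2 : 0 < μ.real (Ioo 0 c0) :=
    ENNReal.toReal_pos (hL _ _ (by linarith) (by linarith) (min_le_right _ _)).ne'
      (measure_ne_top _ _)
  set m := min (μ.real (Ioo (-c0) 0)) (μ.real (Ioo 0 c0)) with hm
  have hm0 : 0 < m := lt_min hm1 hm2
  have hev : ∀ᶠ a : ℝ in 𝓝[<] 1, 0 < a ∧ 1 - 4 * m ^ 2 < a :=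
    nhdsWithin_le_nhds ((lt_mem_nhds one_pos).and (lt_mem_nhds (by nlinarith)))
  filter_upwards [hev] with a ha
  refine iSup₂_le fun x hx => ?_
  by_contra hcon
  refine notMem_limitSet_of_half_add_le hatoms hm0 ha.1 ha.2 ?_ hx
  have hx0 : c0 ≤ |φ x| := hfar x fun z hz => by
    have h1 : (ε : ℝ≥0∞) < ENNReal.ofReal |x - z| := (not_le.1 hcon).trans_le (iInf₂_le z hz)
    have h2 := (ENNReal.lt_ofReal_iff_toReal_lt ENNReal.coe_ne_top).1 h1
    simpa using h2.le
  rcases le_abs.1 hx0 with h | h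
  · left
    have := half_add_le_measureReal_Ioi (μ := μ) hc0pos (neg_le_neg h) hpos
    exact le_trans (by gcongr; exact min_le_left _ _) this
  · right
    have := half_add_le_measureReal_Iio (μ := μ) hc0pos h hneg
    exact le_trans (by gcongr; exact min_le_right _ _) this

/-- Integral bound for a function that is bounded on each side of a point. -/
theorem lintegral_le_of_two_sided (hatoms : ∀ z : ℝ, μ {z} = 0) {c a b : ℝ} (ha : 0 ≤ a)
    (hb : 0 ≤ b) {h : ℝ → ℝ≥0∞} (h1 : ∀ z, c < z → h z ≤ ENNReal.ofReal a)
    (h2 : ∀ z, z < c → h z ≤ ENNReal.ofReal b) :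
    ∫⁻ z, h z ∂μ ≤ ENNReal.ofReal (μ.real (Ioi c) * a + μ.real (Iio c) * b) := by
  have hU : (Ioi c ∪ Iio c : Set ℝ) =ᵐ[μ] univ := by
    filter_upwards [measure_eq_zero_iff_ae_notMem.1 (hatoms c)] with z hz
    have : z ≠ c := hz
    refine propext ⟨fun _ => trivial, fun _ => ?_⟩
    rcases lt_or_gt_of_ne this with h | h
    · exact Or.inr h
    · exact Or.inl h
  rw [← setLIntegral_univ, ← setLIntegral_congr hU,
    ENNReal.ofReal_add (by positivity) (by positivity),
    ENNReal.ofReal_mul measureReal_nonneg, ENNReal.ofReal_mul measureReal_nonneg,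
    ofReal_measureReal, ofReal_measureReal]
  refine (lintegral_union_le _ _ _).trans (add_le_add ?_ ?_)
  · refine (setLIntegral_mono' (g := fun _ => ENNReal.ofReal a) measurableSet_Ioi h1).trans ?_
    rw [setLIntegral_const, mul_comm]
  · refine (setLIntegral_mono' (g := fun _ => ENNReal.ofReal b) measurableSet_Iio h2).trans ?_
    rw [setLIntegral_const, mul_comm]

end SignProbabilities

/-! ### Growth of small step sizes -/

section Drift

variable {φ : ℝ → ℝ} {μ : Measure ℝ} [IsProbabilityMeasure μ] {u d gbar : ℝ}

/-- The points where, for the correction `K` of the sign of the last measurement, the mean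
logarithmic growth of small step sizes is at least `θ`. -/
def growthSet (φ : ℝ → ℝ) (μ : Measure ℝ) (u d K θ : ℝ) : Set ℝ :=
  {x | θ ≤ upProb φ μ x * Real.log u + downProb φ μ x * Real.log d + downProb φ μ x * K} ∩
    {x | θ ≤ downProb φ μ x * Real.log u + upProb φ μ x * Real.log d - upProb φ μ x * K}

/-- The correction of the logarithmic step size by the sign of the last measurement. -/
noncomputable def signCorrection (d K θ y : ℝ) : ℝ :=
  if 0 < y then K else if y < 0 then 0 else |K| + θ - Real.log d

theorem measurable_signCorrection (d K θ : ℝ) : Measurable (signCorrection d K θ) :=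
  Measurable.ite measurableSet_Ioi measurable_const
    (Measurable.ite measurableSet_Iio measurable_const measurable_const)

/-- Lyapunov function for the growth of small step sizes. -/
noncomputable def growthLyapunov (d gbar K θ : ℝ) (e : ℝ × ℝ × ℝ) : ℝ≥0∞ :=
  ENNReal.ofReal (Real.log gbar + |K| - Real.log e.2.1 + signCorrection d K θ e.2.2)

/-- The two inequalities in `growthSet` are precisely the drift conditions after a positive and
after a negative last measurement. The correction at `y = 0` is large enough for any outcome. The
bound `u * γ < gbar` keeps the cap inactive and the function positive before truncation by `ofReal`.
-/
theorem growthLyapunov_drift (hatoms : ∀ z : ℝ, μ {z} = 0) (hu : 1 < u) (hd : 0 < d) (hd' : d < 1)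
    {K θ : ℝ} (hθ : 0 < θ) {e : ℝ × ℝ × ℝ} (hγ : 0 < e.2.1) (hγ' : u * e.2.1 < gbar)
    (he : e.1 ∈ growthSet φ μ u d K θ) :
    ∫⁻ z, (growthLyapunov d gbar K θ (update φ u d gbar e z) + ENNReal.ofReal θ) ∂μ
      ≤ growthLyapunov d gbar K θ e := by
  obtain ⟨x, γ, y⟩ := e
  obtain ⟨he1, he2⟩ := he
  simp only at hγ hγ'
  replace he1 : θ ≤ upProb φ μ x * Real.log u + downProb φ μ x * Real.log d
    + downProb φ μ x * K := he1
  replace he2 : θ ≤ downProb φ μ x * Real.log u + upProb φ μ x * Real.log d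
    - upProb φ μ x * K := he2
  have hs := upProb_add_downProb (φ := φ) hatoms x
  have hp := upProb_nonneg (φ := φ) (μ := μ) x
  have hq := downProb_nonneg (φ := φ) (μ := μ) x
  have hlu : 0 < Real.log u := Real.log_pos hu
  have hld : Real.log d < 0 := Real.log_neg hd hd'
  have hlγu : Real.log (u * γ) = Real.log u + Real.log γ := Real.log_mul (by positivity) hγ.ne'
  have hlγd : Real.log (d * γ) = Real.log d + Real.log γ := Real.log_mul hd.ne' hγ.ne'
  have hlg : Real.log u + Real.log γ ≤ Real.log gbar := by
    rw [← hlγu]; exact Real.log_le_log (by positivity) hγ'.le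
  have hK1 := neg_abs_le K
  have hK2 := le_abs_self K
  have hK3 := abs_nonneg K
  have hK4 : K = upProb φ μ x * K + downProb φ μ x * K := by rw [← add_mul, hs, one_mul]
  have hmin : min (u * γ) gbar = u * γ := min_eq_left hγ'.le
  set c := Real.log gbar + |K| - Real.log γ with hc
  -- `a` and `b` are minus the log of the step size factor plus the new correction, after a positive
  -- and after a negative measurement.
  have hbound : ∀ a b : ℝ, 0 ≤ c + a → 0 ≤ c + b →
      (∀ z, -φ x < z → growthLyapunov d gbar K θ (update φ u d gbar (x, γ, y) z)
        = ENNReal.ofReal (c + a)) →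
      (∀ z, z < -φ x → growthLyapunov d gbar K θ (update φ u d gbar (x, γ, y) z)
        = ENNReal.ofReal (c + b)) →
      upProb φ μ x * a + downProb φ μ x * b + θ ≤ signCorrection d K θ y →
      ∫⁻ z, (growthLyapunov d gbar K θ (update φ u d gbar (x, γ, y) z) + ENNReal.ofReal θ) ∂μ
      ≤ growthLyapunov d gbar K θ (x, γ, y) := by
    intro a b ha hb h1 h2 h3
    have := lintegral_le_of_two_sided (μ := μ) hatoms (c := -φ x) (a := c + a + θ)
      (b := c + b + θ) (by linarith) (by linarith)
      (h := fun z => growthLyapunov d gbar K θ (update φ u d gbar (x, γ, y) z) + ENNReal.ofReal θ)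
      (fun z hz => by rw [h1 z hz, ← ENNReal.ofReal_add ha hθ.le])
      (fun z hz => by rw [h2 z hz, ← ENNReal.ofReal_add hb hθ.le])
    refine this.trans (ENNReal.ofReal_le_ofReal ?_)
    change upProb φ μ x * _ + downProb φ μ x * _ ≤ c + _
    nlinarith
  have hsp : ∀ z, -φ x < z → 0 < φ x + z := fun z hz => by linarith
  have hsn : ∀ z, z < -φ x → φ x + z < 0 := fun z hz => by linarith
  rcases lt_trichotomy y 0 with hy | hy | hy
  · refine hbound (K - Real.log d) (-Real.log u) (by linarith) (by linarith) (fun z hz => ?_)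
      (fun z hz => ?_) ?_
    · have h0 := hsp z hz
      have h1 : ¬ 0 < y * (φ x + z) := not_lt.2 (mul_nonpos_of_nonpos_of_nonneg hy.le h0.le)
      simp only [growthLyapunov, update, newStep, h1, if_false, signCorrection, h0, if_true, hlγd]
      congr 1; rw [hc]; ring
    · have h0 := hsn z hz
      have h1 : 0 < y * (φ x + z) := mul_pos_of_neg_of_neg hy h0
      simp only [growthLyapunov, update, newStep, h1, signCorrection, h0, if_true, hmin, hlγu,
        h0.not_gt, if_false]
      congr 1; rw [hc]; ring
    · simp only [signCorrection, hy, hy.not_gt, if_true, if_false]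
      linarith
  · refine hbound (K - Real.log d) (-Real.log d) (by linarith) (by linarith) (fun z hz => ?_)
      (fun z hz => ?_) ?_
    · have h0 := hsp z hz
      have h1 : ¬ 0 < y * (φ x + z) := by simp [hy]
      simp only [growthLyapunov, update, newStep, h1, if_false, signCorrection, h0, if_true, hlγd]
      congr 1; rw [hc]; ring
    · have h0 := hsn z hz
      have h1 : ¬ 0 < y * (φ x + z) := by simp [hy]
      simp only [growthLyapunov, update, newStep, h1, signCorrection, h0, if_true, hlγd,
        h0.not_gt, if_false]
      congr 1; rw [hc]; ring
    · simp only [signCorrection, hy, lt_irrefl, if_false]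
      nlinarith
  · refine hbound (K - Real.log u) (-Real.log d) (by linarith) (by linarith) (fun z hz => ?_)
      (fun z hz => ?_) ?_
    · have h0 := hsp z hz
      have h1 : 0 < y * (φ x + z) := mul_pos hy h0
      simp only [growthLyapunov, update, newStep, h1, if_true, signCorrection, h0, hlγu, hmin]
      congr 1; rw [hc]; ring
    · have h0 := hsn z hz
      have h1 : ¬ 0 < y * (φ x + z) := not_lt.2 (mul_nonpos_of_nonneg_of_nonpos hy.le h0.le)
      simp only [growthLyapunov, update, newStep, h1, signCorrection, h0, if_true, hlγd,
        h0.not_gt, if_false]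
      congr 1; rw [hc]; ring
    · simp only [signCorrection, hy, if_true]
      nlinarith

end Drift

/-! ### Limits have nonpositive growth -/

section NoLimit

variable {Ω : Type*} [mΩ : MeasurableSpace Ω] {P : Measure Ω} [IsProbabilityMeasure P]
  {φ : ℝ → ℝ} {μ : Measure ℝ} [IsProbabilityMeasure μ] {u d gbar : ℝ} {x γ y ξ : ℕ → Ω → ℝ}

/-- Staying forever would dissipate `θ` at every step, an infinite total against a finite initial
Lyapunov value. -/
theorem ae_not_forall_mem_growthSet (hφ : Continuous φ) (hatoms : ∀ z : ℝ, μ {z} = 0)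
    (hu : 1 < u) (hd : 0 < d) (hd' : d < 1) (h : IsRun φ u d gbar x γ y ξ)
    (hn : NoiseCondition P μ x γ ξ) {K θ : ℝ} (hθ : 0 < θ) :
    ∀ᵐ ω ∂P, ∀ T, ¬ ∀ t, T ≤ t →
      x (t + 1) ω ∈ growthSet φ μ u d K θ ∧ u * γ (t + 1) ω < gbar := by
  have hch := h.isChain hφ.measurable hn
  have hp : Measurable (upProb φ μ) := (continuous_upProb hφ hatoms).measurable
  have hq : Measurable (downProb φ μ) := (continuous_downProb hφ hatoms).measurable
  have hJ : MeasurableSet (growthSet φ μ u d K θ) :=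
    (measurableSet_le measurable_const (by fun_prop)).inter
      (measurableSet_le measurable_const (by fun_prop))
  set G : Set (ℝ × ℝ × ℝ) :=
    {e | e.1 ∈ growthSet φ μ u d K θ} ∩ ({e | 0 < e.2.1} ∩ {e | u * e.2.1 < gbar}) with hG
  have hGm : MeasurableSet G := (measurable_fst hJ).inter
    ((measurableSet_lt measurable_const (by fun_prop)).inter
      (measurableSet_lt (by fun_prop) measurable_const))
  have hV : Measurable (growthLyapunov d gbar K θ) := by
    have h1 := (measurable_signCorrection d K θ).comp
      (show Measurable fun e : ℝ × ℝ × ℝ => e.2.2 by fun_prop)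
    have h2 : Measurable fun e : ℝ × ℝ × ℝ => Real.log e.2.1 := by fun_prop
    exact ((measurable_const.sub h2).add h1).ennreal_ofReal
  have := hch.ae_tsum_lt_top hGm hV (fun e => ENNReal.ofReal_ne_top)
    (g := fun _ => ENNReal.ofReal θ) measurable_const
    (fun e he => growthLyapunov_drift hatoms hu hd hd' hθ he.2.1 he.2.2 he.1)
  filter_upwards [this] with ω hω T hT
  have h1 := hω T fun t ht => ⟨(hT t ht).1, (h.stepSize_mem hu hd hd' t ω).1, (hT t ht).2⟩
  rw [ENNReal.tsum_const_eq_top_of_ne_zero (by simpa using hθ)] at h1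
  exact lt_irrefl _ h1

/-- Noise of size at least L/2 with the sign of φ has probability bounded below and gives a
measurement of at least that size. -/
theorem ae_frequently_large_increment (hφ : Continuous φ) (hatoms : ∀ z : ℝ, μ {z} = 0)
    {L : ℝ} (hL0 : 0 < L) (hL : ∀ a b : ℝ, -L ≤ a → a < b → b ≤ L → 0 < μ (Ioo a b))
    (hu : 1 < u) (hd : 0 < d) (hd' : d < 1) (hg : 0 < gbar) (h : IsRun φ u d gbar x γ y ξ)
    (hn : NoiseCondition P μ x γ ξ) :
    ∃ δ > 0, ∀ᵐ ω ∂P, (∃ᶠ t in atTop, gbar ≤ u * γ (t + 1) ω) →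
      ∃ᶠ t in atTop, δ ≤ |x (t + 1) ω - x t ω| := by
  have hch := h.isChain hφ.measurable hn
  obtain ⟨c, hc, hcL⟩ := exists_forall_le_measure_Ioo hatoms hL (half_pos hL0)
  set Q : Set (ℝ × ℝ × ℝ) := {e | gbar ≤ u * e.2.1} ∩ {e | e.2.1 ≤ gbar} with hQ
  -- The new state remembers only the new step size, whereas the increment uses the old one. As a
  -- step grows by at most a factor `u`, the old one is at least `d * gbar / u ^ 2`.
  set Q' : Set (ℝ × ℝ × ℝ) := {e | d * gbar ≤ u * e.2.1} ∩ {e | L / 2 ≤ |e.2.2|} with hQ'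
  have hQm : MeasurableSet Q := (measurableSet_le measurable_const (by fun_prop)).inter
    (measurableSet_le (by fun_prop) measurable_const)
  have hQm' : MeasurableSet Q' := (measurableSet_le measurable_const (by fun_prop)).inter
    (measurableSet_le measurable_const (by fun_prop))
  have hu0 : 0 < u := by linarith
  have key := hch.frequently_of_frequently hQm hQm' hc (by
    rintro ⟨x, γ, y⟩ ⟨h1, h2⟩
    change gbar ≤ u * γ at h1
    change γ ≤ gbar at h2
    have hγ' : ∀ y', d * gbar ≤ u * newStep u d gbar γ y y' := by
      intro y'
      unfold newStep
      split_ifs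
      · rw [mul_min_of_nonneg _ _ hu0.le]
        exact le_min (by nlinarith) (by nlinarith)
      · nlinarith
    rcases le_total 0 (φ x) with h0 | h0
    · refine (hcL (L / 2) (by linarith) (by linarith)).trans (measure_mono fun z hz => ?_)
      refine ⟨hγ' _, ?_⟩
      change L / 2 ≤ |φ x + z|
      exact le_abs.2 (Or.inl (by linarith [hz.1]))
    · refine (hcL (-L) (by linarith) (by linarith)).trans (measure_mono fun z hz => ?_)
      refine ⟨hγ' _, ?_⟩
      change L / 2 ≤ |φ x + z|
      exact le_abs.2 (Or.inr (by linarith [hz.2])))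
  refine ⟨d * gbar / u ^ 2 * (L / 2), by positivity, ?_⟩
  filter_upwards [key] with ω hω hfreq
  have h1 := hω (hfreq.mono fun t ht => ⟨ht, (h.stepSize_mem hu hd hd' t ω).2⟩)
  rw [frequently_atTop] at h1 ⊢
  intro n
  obtain ⟨t, ht, h2, h3⟩ := h1 (n + 1)
  obtain ⟨t, rfl⟩ : ∃ k, t = k + 1 := ⟨t - 1, by omega⟩
  change d * gbar ≤ u * γ (t + 2) ω at h2
  change L / 2 ≤ |y (t + 2) ω| at h3
  refine ⟨t + 1, by omega, ?_⟩
  have hγ := h.stepSize_mem hu hd hd' t ω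
  have h4 : γ (t + 2) ω ≤ u * γ (t + 1) ω := by
    rw [h.stepSize_eq]; exact newStep_le hu hd' hγ.1
  rw [h.step, sub_sub_cancel_left, abs_neg, abs_mul, abs_of_pos hγ.1]
  refine mul_le_mul ?_ h3 (by positivity) hγ.1.le
  rw [div_le_iff₀ (by positivity)]
  nlinarith

/-- Almost surely, limits of the iterates are points of nonpositive mean logarithmic growth. -/
theorem ae_growth_nonpos_of_tendsto (hφ : Continuous φ) (hatoms : ∀ z : ℝ, μ {z} = 0)
    {L : ℝ} (hL0 : 0 < L) (hL : ∀ a b : ℝ, -L ≤ a → a < b → b ≤ L → 0 < μ (Ioo a b))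
    (hu : 1 < u) (hd : 0 < d) (hd' : d < 1) (hg : 0 < gbar) (h : IsRun φ u d gbar x γ y ξ)
    (hn : NoiseCondition P μ x γ ξ) :
    ∀ᵐ ω ∂P, ∀ p, Tendsto (fun t => x t ω) atTop (𝓝 p) →
      (upProb φ μ p ^ 2 + downProb φ μ p ^ 2) * Real.log u
        + 2 * upProb φ μ p * downProb φ μ p * Real.log d ≤ 0 := by
  obtain ⟨δ, hδ, hinc⟩ := ae_frequently_large_increment hφ hatoms hL0 hL hu hd hd' hg h hn
  -- The limit point depends on ω; rational parameters leave only countably many null sets.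
  have hgr : ∀ᵐ ω ∂P, ∀ K θ : ℚ, 0 < θ → ∀ T, ¬ ∀ t, T ≤ t →
      x (t + 1) ω ∈ growthSet φ μ u d K θ ∧ u * γ (t + 1) ω < gbar := by
    rw [ae_all_iff]; intro K
    rw [ae_all_iff]; intro θ
    by_cases hθ : 0 < θ
    · filter_upwards [ae_not_forall_mem_growthSet hφ hatoms hu hd hd' h hn (K := K) (θ := θ)
        (by exact_mod_cast hθ)] with ω hω _ using hω
    · exact Eventually.of_forall fun ω h0 => absurd h0 hθ
  filter_upwards [hinc, hgr] with ω h1 h2 p hp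
  by_contra! hD
  have hs := upProb_add_downProb (φ := φ) hatoms p
  have hp0 := upProb_nonneg (φ := φ) (μ := μ) p
  have hq0 := downProb_nonneg (φ := φ) (μ := μ) p
  have hcp := (continuous_upProb (μ := μ) hφ hatoms).continuousAt.tendsto.comp hp
  have hcq := (continuous_downProb (μ := μ) hφ hatoms).continuousAt.tendsto.comp hp
  set a := upProb φ μ p
  set b := downProb φ μ p
  set D := (a ^ 2 + b ^ 2) * Real.log u + 2 * a * b * Real.log d with hDdef
  -- The solution of the Poisson equation for the sign chain: with this correction both growth
  -- expressions at `p` equal `D`. A rational `K` within `D / 2` of it keeps both above `θ`.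
  set K0 := (b - a) * (Real.log u - Real.log d) with hK0
  obtain ⟨K, hK1, hK2⟩ := exists_rat_btwn (show K0 < K0 + D / 2 by linarith)
  obtain ⟨θ, hθ1, hθ2⟩ := exists_rat_btwn (show 0 < D / 2 by linarith)
  have hb : b = 1 - a := by linarith
  have e1 : a * Real.log u + b * Real.log d + b * K0 = D := by
    rw [hK0, hDdef, hb]; ring
  have e2 : b * Real.log u + a * Real.log d - a * K0 = D := by
    rw [hK0, hDdef, hb]; ring
  have i1 : (θ : ℝ) < a * Real.log u + b * Real.log d + b * K := by nlinarith
  have i2 : (θ : ℝ) < b * Real.log u + a * Real.log d - a * K := by nlinarith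
  have t1 := ((hcp.mul_const (Real.log u)).add (hcq.mul_const (Real.log d))).add
    (hcq.mul_const (K : ℝ))
  have t2 := ((hcq.mul_const (Real.log u)).add (hcp.mul_const (Real.log d))).sub
    (hcp.mul_const (K : ℝ))
  have hev : ∀ᶠ t in atTop, x t ω ∈ growthSet φ μ u d K θ := by
    filter_upwards [t1.eventually (lt_mem_nhds i1), t2.eventually (lt_mem_nhds i2)] with t h3 h4
    exact ⟨h3.le, h4.le⟩
  have hsmall : ∀ᶠ t in atTop, |x (t + 1) ω - x t ω| < δ := by
    have h3 := ((hp.comp (tendsto_add_atTop_nat 1)).sub hp).abs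
    simp only [sub_self, abs_zero] at h3
    exact h3.eventually (gt_mem_nhds hδ)
  have hγ : ∀ᶠ t in atTop, u * γ (t + 1) ω < gbar := by
    by_contra hnot
    rw [not_eventually] at hnot
    have := h1 (hnot.mono fun t ht => not_lt.1 ht)
    obtain ⟨t, h3, h4⟩ := (this.and_eventually hsmall).exists
    linarith
  obtain ⟨T, hT⟩ := eventually_atTop.1 (((tendsto_add_atTop_nat 1).eventually hev).and hγ)
  exact h2 K θ (by exact_mod_cast hθ1) T hT

end NoLimit

/-! ### Contraction of powers of the step size -/

section Contraction

/-- The function of the exponent equals 1 at 0, where its derivative is the negative logarithmic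
mean. -/
theorem exists_rpow_contraction {u d r : ℝ} (hu : 0 < u) (hd : 0 < d)
    (h : (1 - r) * Real.log u + r * Real.log d < 0) :
    ∃ ε : ℝ, 0 < ε ∧ ε ≤ 1 ∧ (1 - r) * u ^ ε + r * d ^ ε < 1 := by
  have hder : HasDerivAt (fun s : ℝ => (1 - r) * u ^ s + r * d ^ s)
      ((1 - r) * Real.log u + r * Real.log d) 0 := by
    have h1 := (Real.hasStrictDerivAt_const_rpow hu 0).hasDerivAt.const_mul (1 - r)
    have h2 := (Real.hasStrictDerivAt_const_rpow hd 0).hasDerivAt.const_mul r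
    exact (h1.add h2).congr_deriv (by simp)
  have hs := hasDerivAt_iff_tendsto_slope.1 hder
  have h1 : ∀ᶠ s in 𝓝[>] (0 : ℝ), slope (fun s : ℝ => (1 - r) * u ^ s + r * d ^ s) 0 s < 0 :=
    (hs.eventually (gt_mem_nhds h)).filter_mono (nhdsWithin_mono _ fun s (hs : 0 < s) => hs.ne')
  have h2 : ∀ᶠ s in 𝓝[>] (0 : ℝ), s ∈ Ioc (0 : ℝ) 1 := Ioc_mem_nhdsGT one_pos
  obtain ⟨ε, h3, h4, h5⟩ := (h1.and h2).exists
  refine ⟨ε, h4, h5, ?_⟩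
  rw [slope_def_field, div_neg_iff] at h3
  rcases h3 with h3 | h3
  · linarith [h3.2]
  · have : (1 - r) * u ^ ε + r * d ^ ε - ((1 - r) * u ^ (0 : ℝ) + r * d ^ (0 : ℝ)) < 0 := h3.1
    rw [Real.rpow_zero, Real.rpow_zero, mul_one, mul_one, sub_add_cancel] at this
    exact sub_neg.1 this

/-- If `u * d < 1`, a sign change rate below one half still makes the step size contract. -/
theorem exists_rate_lt_half {u d : ℝ} (hu : 1 < u) (hd : 0 < d) (hud : u * d < 1) :
    ∃ r, 0 < r ∧ r < 1 / 2 ∧ (1 - r) * Real.log u + r * Real.log d < 0 := by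
  have h0 : Real.log u + Real.log d < 0 := by
    rw [← Real.log_mul (by positivity) hd.ne']
    exact Real.log_neg (by positivity) hud
  have hlu := Real.log_pos hu
  have hc : ContinuousAt (fun r : ℝ => (1 - r) * Real.log u + r * Real.log d) (1 / 2) := by
    fun_prop
  have h1 : ∀ᶠ r in 𝓝[<] (1 / 2 : ℝ), (1 - r) * Real.log u + r * Real.log d < 0 :=
    nhdsWithin_le_nhds (hc.eventually (gt_mem_nhds (by linarith)))
  have h2 : ∀ᶠ r in 𝓝[<] (1 / 2 : ℝ), r ∈ Ioo (0 : ℝ) (1 / 2) := Ioo_mem_nhdsLT (by norm_num)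
  obtain ⟨r, h3, h4, h5⟩ := (h1.and h2).exists
  exact ⟨r, h4, h5, h3⟩

theorem exists_sign_change_rate {μ : Measure ℝ} [IsProbabilityMeasure μ]
    (hatoms : ∀ z : ℝ, μ {z} = 0) (hpos : μ (Ioi 0) = 1 / 2) (hneg : μ (Iio 0) = 1 / 2) {r : ℝ}
    (hr : r < 1 / 2) :
    ∃ a > 0, ∀ b, |b| ≤ a → r ≤ μ.real (Ioi b) ∧ r ≤ μ.real (Iio b) := by
  have hF := continuous_measureReal_Iio hatoms
  have hG : Continuous fun a => μ.real (Ioi a) := by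
    simp_rw [measureReal_Ioi_eq hatoms]; fun_prop
  have h1 : ∀ᶠ b in 𝓝 (0 : ℝ), r < μ.real (Ioi b) ∧ r < μ.real (Iio b) :=
    (hG.continuousAt.eventually (lt_mem_nhds (by simp [Measure.real, hpos]; linarith))).and
      (hF.continuousAt.eventually (lt_mem_nhds (by simp [Measure.real, hneg]; linarith)))
  obtain ⟨a, ha, h2⟩ := Metric.eventually_nhds_iff.1 h1
  refine ⟨a / 2, half_pos ha, fun b hb => ?_⟩
  have := @h2 b (by rw [dist_zero_right, Real.norm_eq_abs]; linarith)
  exact ⟨this.1.le, this.2.le⟩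

theorem rpow_sum_le_sum_rpow {ι : Type*} (s : Finset ι) (a : ι → ℝ) (ha : ∀ i, 0 ≤ a i) {ε : ℝ}
    (hε : 0 < ε) (hε' : ε ≤ 1) : (∑ i ∈ s, a i) ^ ε ≤ ∑ i ∈ s, a i ^ ε := by
  classical
  induction s using Finset.induction_on with
  | empty => simp [Real.zero_rpow hε.ne']
  | insert i s hi ih =>
    rw [Finset.sum_insert hi, Finset.sum_insert hi]
    refine (Real.rpow_add_le_add_rpow (ha i) (Finset.sum_nonneg fun j _ => ha j) hε.le hε').trans ?_
    gcongr

theorem exists_tendsto_of_sum_abs_sub_le {X : ℕ → ℝ} {c : ℝ}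
    (h : ∀ k, ∑ i ∈ Finset.range k, |X (i + 1) - X i| ≤ c) : ∃ p, Tendsto X atTop (𝓝 p) := by
  refine cauchySeq_tendsto_of_complete (cauchySeq_of_summable_dist ?_)
  refine summable_of_sum_range_le (c := c) (fun _ => dist_nonneg) fun k => ?_
  simpa [dist_comm (X _) (X (_ + 1)), Real.dist_eq] using h k

/-- A bootstrap: by subadditivity of the power, a bound on the ε-sums bounds the path length by δ/M.
Then φ moves by at most δ, so |φ| ≤ 2δ persists and the hypothesis applies at the next index. -/
theorem exists_tendsto_of_sum_rpow_le {φ : ℝ → ℝ} {M δ ε : ℝ} (hM : 0 < M) (hδ : 0 < δ)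
    (hlip : ∀ a b, |φ a - φ b| ≤ M * |a - b|) (hε : 0 < ε) (hε' : ε ≤ 1) {X : ℕ → ℝ}
    (h0 : |φ (X 0)| ≤ δ)
    (h : ∀ k, (∀ i ≤ k, |φ (X i)| ≤ 2 * δ) →
      ∑ i ∈ Finset.range (k + 1), |X (i + 1) - X i| ^ ε ≤ (δ / M) ^ ε) :
    ∃ p, Tendsto X atTop (𝓝 p) := by
  have hsum : ∀ k, (∀ i ≤ k, |φ (X i)| ≤ 2 * δ) →
      ∑ i ∈ Finset.range (k + 1), |X (i + 1) - X i| ≤ δ / M := by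
    intro k hk
    have h1 := (rpow_sum_le_sum_rpow (Finset.range (k + 1)) (fun i => |X (i + 1) - X i|)
      (fun i => abs_nonneg _) hε hε').trans (h k hk)
    exact (Real.rpow_le_rpow_iff (Finset.sum_nonneg fun i _ => abs_nonneg _)
      (by positivity) hε).1 h1
  have hstay : ∀ k, ∀ i ≤ k, |φ (X i)| ≤ 2 * δ := by
    intro k
    induction k with
    | zero =>
      intro i hi
      obtain rfl : i = 0 := by omega
      linarith
    | succ k ih =>
      intro i hi
      rcases Nat.lt_or_ge i (k + 1) with h1 | h1
      · exact ih i (by omega)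
      · obtain rfl : i = k + 1 := by omega
        have h2 : |X (k + 1) - X 0| ≤ δ / M := by
          rw [← Finset.sum_range_sub X (k + 1)]
          exact (Finset.abs_sum_le_sum_abs _ _).trans (hsum k ih)
        have h3 := hlip (X (k + 1)) (X 0)
        have h4 : M * |X (k + 1) - X 0| ≤ δ := by
          rw [le_div_iff₀ hM] at h2; linarith
        have h5 : |φ (X (k + 1))| ≤ |φ (X (k + 1)) - φ (X 0)| + |φ (X 0)| := by
          simpa using abs_add_le (φ (X (k + 1)) - φ (X 0)) (φ (X 0))
        linarith
  refine exists_tendsto_of_sum_abs_sub_le (c := δ / M) fun k => ?_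
  refine le_trans ?_ (hsum k (hstay k))
  exact Finset.sum_le_sum_of_subset_of_nonneg (Finset.range_mono (by omega))
    fun _ _ _ => abs_nonneg _

end Contraction

/-! ### The trap: φ and the step size both small -/

section Trap

variable {φ : ℝ → ℝ} {μ : Measure ℝ} [IsProbabilityMeasure μ] {u d gbar : ℝ}

theorem rpow_le_one_add {t ε : ℝ} (ht : 0 ≤ t) (hε : 0 < ε) (hε' : ε ≤ 1) : t ^ ε ≤ 1 + t := by
  rcases le_total t 1 with h | h
  · linarith [Real.rpow_le_one ht h hε.le]
  · have := Real.rpow_le_rpow_of_exponent_le h hε'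
    rw [Real.rpow_one] at this
    linarith

/-- Near the zeros of `φ`, a power of the step size is a Lyapunov function. -/
theorem trap_drift (hatoms : ∀ z : ℝ, μ {z} = 0) (hint : Integrable (fun z : ℝ => z) μ)
    (hu : 1 < u) (hd : 0 < d) (hd' : d < 1) {r ε δ : ℝ} (hε : 0 < ε) (hε' : ε ≤ 1)
    (hδ : 0 < δ) (hr : 0 < r) (hr' : r < 1 / 2)
    (hρ : (1 - r) * u ^ ε + r * d ^ ε < 1)
    (hrate : ∀ b, |b| ≤ 2 * δ → r ≤ μ.real (Ioi b) ∧ r ≤ μ.real (Iio b)) {C : ℝ}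
    (hC : 1 + 2 * δ + ∫ z, |z| ∂μ = C * (1 - ((1 - r) * u ^ ε + r * d ^ ε)))
    {e : ℝ × ℝ × ℝ} (hγ : 0 < e.2.1) (hγ' : e.2.1 ≤ gbar) (he : |φ e.1| ≤ 2 * δ) :
    ∫⁻ z, (ENNReal.ofReal (C * (update φ u d gbar e z).2.1 ^ ε)
      + ENNReal.ofReal ((e.2.1 * |φ e.1 + z|) ^ ε)) ∂μ ≤ ENNReal.ofReal (C * e.2.1 ^ ε) := by
  obtain ⟨x, γ, y⟩ := e
  simp only at hγ hγ' he
  have hu0 : 0 < u := by linarith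
  have hI : 0 ≤ ∫ z, |z| ∂μ := integral_nonneg fun z => abs_nonneg z
  set I := ∫ z, |z| ∂μ with hIdef
  set ρ := (1 - r) * u ^ ε + r * d ^ ε with hρdef
  have hCpos : 0 < C := by
    have : 0 < C * (1 - ρ) := by rw [← hC]; linarith
    exact pos_of_mul_pos_left this (by linarith)
  have hud : d ^ ε ≤ u ^ ε := Real.rpow_le_rpow hd.le (by linarith) hε.le
  have hγε : 0 < γ ^ ε := Real.rpow_pos_of_pos hγ _
  have hb := hrate (-φ x) (by rwa [abs_neg])
  have hsum : μ.real (Ioi (-φ x)) = 1 - μ.real (Iio (-φ x)) := measureReal_Ioi_eq hatoms _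
  have hup : ∀ y', newStep u d gbar γ y y' ^ ε ≤ u ^ ε * γ ^ ε := by
    intro y'
    rw [← Real.mul_rpow hu0.le hγ.le]
    unfold newStep
    split_ifs with h
    · rcases le_total (u * γ) gbar with h1 | h1
      · rw [min_eq_left h1]
      · rw [min_eq_right h1]
        exact Real.rpow_le_rpow (hγ.le.trans hγ') h1 hε.le
    · exact Real.rpow_le_rpow (by positivity) (by nlinarith) hε.le
  have hdown : ∀ y', y * y' ≤ 0 → newStep u d gbar γ y y' ^ ε = d ^ ε * γ ^ ε := by
    intro y' h
    rw [← Real.mul_rpow hd.le hγ.le, newStep, if_neg (not_lt.2 h)]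
  -- Whatever the last measurement, the next one makes the product nonpositive with probability at
  -- least `r`, and the factor is then `d`; otherwise it is at most `u`.
  have h1 : ∫⁻ z, ENNReal.ofReal (C * (update φ u d gbar (x, γ, y) z).2.1 ^ ε) ∂μ
      ≤ ENNReal.ofReal (C * (ρ * γ ^ ε)) := by
    have hU : ∀ z, ENNReal.ofReal (C * (update φ u d gbar (x, γ, y) z).2.1 ^ ε)
        ≤ ENNReal.ofReal (C * (u ^ ε * γ ^ ε)) := fun z =>
      ENNReal.ofReal_le_ofReal (mul_le_mul_of_nonneg_left (hup _) hCpos.le)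
    rcases le_or_gt y 0 with hy | hy
    · refine (lintegral_le_of_two_sided hatoms (c := -φ x) (a := C * (d ^ ε * γ ^ ε))
        (b := C * (u ^ ε * γ ^ ε)) (by positivity) (by positivity) (fun z hz => ?_)
        (fun z _ => hU z)).trans (ENNReal.ofReal_le_ofReal ?_)
      · exact (congrArg (fun t => ENNReal.ofReal (C * t))
          (hdown _ (mul_nonpos_of_nonpos_of_nonneg hy (by linarith)))).le
      · have : μ.real (Ioi (-φ x)) * d ^ ε + μ.real (Iio (-φ x)) * u ^ ε ≤ ρ := by
          have h0 := mul_nonneg (sub_nonneg.2 hb.1) (sub_nonneg.2 hud)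
          rw [hρdef]
          rw [hsum] at *
          linarith
        calc _ = C * ((μ.real (Ioi (-φ x)) * d ^ ε + μ.real (Iio (-φ x)) * u ^ ε) * γ ^ ε) := by
              ring
          _ ≤ _ := by gcongr
    · refine (lintegral_le_of_two_sided hatoms (c := -φ x) (a := C * (u ^ ε * γ ^ ε))
        (b := C * (d ^ ε * γ ^ ε)) (by positivity) (by positivity) (fun z _ => hU z)
        (fun z hz => ?_)).trans (ENNReal.ofReal_le_ofReal ?_)
      · exact (congrArg (fun t => ENNReal.ofReal (C * t))
          (hdown _ (mul_nonpos_of_nonneg_of_nonpos hy.le (by linarith)))).le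
      · have : μ.real (Ioi (-φ x)) * u ^ ε + μ.real (Iio (-φ x)) * d ^ ε ≤ ρ := by
          have h0 := mul_nonneg (sub_nonneg.2 hb.2) (sub_nonneg.2 hud)
          rw [hρdef]
          rw [hsum] at *
          linarith
        calc _ = C * ((μ.real (Ioi (-φ x)) * u ^ ε + μ.real (Iio (-φ x)) * d ^ ε) * γ ^ ε) := by
              ring
          _ ≤ _ := by gcongr
  have h2 : ∫⁻ z, ENNReal.ofReal ((γ * |φ x + z|) ^ ε) ∂μ
      ≤ ENNReal.ofReal (γ ^ ε * (1 + 2 * δ + I)) := by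
    have hi : Integrable (fun z : ℝ => γ ^ ε * (1 + 2 * δ + |z|)) μ :=
      ((integrable_const _).add hint.abs).const_mul _
    have e1 : ∫ z, γ ^ ε * (1 + 2 * δ + |z|) ∂μ = γ ^ ε * (1 + 2 * δ + I) := by
      rw [integral_const_mul, integral_add (integrable_const _) hint.abs]
      simp [hIdef]
    rw [← e1, ofReal_integral_eq_lintegral_ofReal hi
      (Eventually.of_forall fun z => by positivity)]
    refine lintegral_mono fun z => ENNReal.ofReal_le_ofReal ?_
    rw [Real.mul_rpow hγ.le (abs_nonneg _)]
    refine mul_le_mul_of_nonneg_left ((rpow_le_one_add (abs_nonneg _) hε hε').trans ?_) hγε.le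
    linarith [abs_add_le (φ x) z]
  rw [lintegral_add_right]
  · refine (add_le_add h1 h2).trans ?_
    have hρ0 : 0 ≤ ρ := add_nonneg (mul_nonneg (by linarith) (by positivity)) (by positivity)
    rw [← ENNReal.ofReal_add (by positivity) (by positivity)]
    -- `C` is chosen so that the loss `C * (1 - ρ)` pays exactly for the bound on the mean ε-power
    -- of the increment.
    refine ENNReal.ofReal_le_ofReal (le_of_eq ?_)
    rw [hC]; ring
  · fun_prop

variable {Ω : Type*} [mΩ : MeasurableSpace Ω] {P : Measure Ω} [IsProbabilityMeasure P]
  {ℱ : Filtration ℕ mΩ} {s : ℕ → Ω → ℝ × ℝ × ℝ} {ζ : ℕ → Ω → ℝ}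

/-- If the iterate is near a zero of `φ` with a small step size infinitely often, then the
iterates converge. -/
theorem ae_tendsto_of_frequently_trap (hφ : Continuous φ) {M : ℝ} (hM : 0 < M)
    (hlip : ∀ a b, |φ a - φ b| ≤ M * |a - b|)
    (hatoms : ∀ z : ℝ, μ {z} = 0) (hint : Integrable (fun z : ℝ => z) μ)
    (hu : 1 < u) (hd : 0 < d) (hd' : d < 1) {r ε δ : ℝ} (hε : 0 < ε) (hε' : ε ≤ 1)
    (hδ : 0 < δ) (hr : 0 < r) (hr' : r < 1 / 2)
    (hρ : (1 - r) * u ^ ε + r * d ^ ε < 1)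
    (hrate : ∀ b, |b| ≤ 2 * δ → r ≤ μ.real (Ioi b) ∧ r ≤ μ.real (Iio b))
    (hch : IsChain P μ (update φ u d gbar) ℱ s ζ) (hs : ∀ t ω, (s t ω).2.1 ∈ Ioc 0 gbar) :
    ∃ γ₁ > 0, ∀ γ' ≤ γ₁, ∀ᵐ ω ∂P, (∃ᶠ t in atTop, |φ (s t ω).1| ≤ δ ∧ (s t ω).2.1 ≤ γ') →
      ∃ p, Tendsto (fun t => (s t ω).1) atTop (𝓝 p) := by
  set ρ := (1 - r) * u ^ ε + r * d ^ ε with hρdef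
  have hI : 0 ≤ ∫ z, |z| ∂μ := integral_nonneg fun z => abs_nonneg z
  set C := (1 + 2 * δ + ∫ z, |z| ∂μ) / (1 - ρ) with hCdef
  have hC : 1 + 2 * δ + ∫ z, |z| ∂μ = C * (1 - ρ) := by
    rw [hCdef, div_mul_cancel₀]; linarith
  have hCpos : 0 < C := div_pos (by linarith) (by linarith)
  set θ := (δ / M) ^ ε with hθdef
  have hθ : 0 < θ := Real.rpow_pos_of_pos (by positivity) _
  -- Below this step size the Lyapunov function is at most `θ / 2`, so by Markov's inequality the
  -- dissipation reaches `θ` with conditional probability at most 1/2.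
  refine ⟨(θ / (2 * C)) ^ ε⁻¹, Real.rpow_pos_of_pos (by positivity) _, fun γ' hγ' => ?_⟩
  have hsmall : ∀ γ, 0 < γ → γ ≤ γ' → C * γ ^ ε ≤ θ / 2 := by
    intro γ h1 h2
    have h3 : γ ^ ε ≤ θ / (2 * C) := by
      calc γ ^ ε ≤ ((θ / (2 * C)) ^ ε⁻¹) ^ ε :=
            Real.rpow_le_rpow h1.le (h2.trans hγ') hε.le
        _ = θ / (2 * C) := by
            rw [← Real.rpow_mul (by positivity), inv_mul_cancel₀ hε.ne', Real.rpow_one]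
    calc C * γ ^ ε ≤ C * (θ / (2 * C)) := by gcongr
      _ = θ / 2 := by field_simp
  set G : Set (ℝ × ℝ × ℝ) :=
    {e | 0 < e.2.1} ∩ ({e | e.2.1 ≤ gbar} ∩ {e | |φ e.1| ≤ 2 * δ}) with hG
  have hφ1 : Measurable fun e : ℝ × ℝ × ℝ => |φ e.1| := by
    have : Continuous fun e : ℝ × ℝ × ℝ => |φ e.1| := by fun_prop
    exact this.measurable
  have hGm : MeasurableSet G := (measurableSet_lt measurable_const (by fun_prop)).inter
    ((measurableSet_le (by fun_prop) measurable_const).inter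
      (measurableSet_le hφ1 measurable_const))
  set V : ℝ × ℝ × ℝ → ℝ≥0∞ := fun e => ENNReal.ofReal (C * e.2.1 ^ ε) with hV
  set g : (ℝ × ℝ × ℝ) × ℝ → ℝ≥0∞ :=
    fun q => ENNReal.ofReal ((q.1.2.1 * |φ q.1.1 + q.2|) ^ ε) with hg
  have hVm : Measurable V := by fun_prop
  have hgm : Measurable g := by
    have : Measurable fun q : (ℝ × ℝ × ℝ) × ℝ => |φ q.1.1 + q.2| := by
      have : Continuous fun q : (ℝ × ℝ × ℝ) × ℝ => |φ q.1.1 + q.2| := by fun_prop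
      exact this.measurable
    fun_prop
  have hdrift : ∀ e ∈ G, ∫⁻ z, (V (update φ u d gbar e z) + g (e, z)) ∂μ ≤ V e := fun e he =>
    trap_drift hatoms hint hu hd hd' hε hε' hδ hr hr' hρ hrate hC he.1 he.2.1 he.2.2
  set Cv : Set Ω := {ω | ∃ p, Tendsto (fun t => (s t ω).1) atTop (𝓝 p)} with hCv
  have hCm : MeasurableSet[⨆ t, ℱ t] Cv := by
    refine @measurableSet_exists_tendsto ℕ ℝ Ω (⨆ t, ℱ t) _ _ _ _ _ _ _ _ _ fun t => ?_
    exact (measurable_fst.comp (hch.adapted t)).mono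
      (le_iSup (fun t => (ℱ t : MeasurableSpace Ω)) t) le_rfl
  have hH : MeasurableSet ({e : ℝ × ℝ × ℝ | |φ e.1| ≤ δ} ∩ {e | e.2.1 ≤ γ'}) :=
    (measurableSet_le hφ1 measurable_const).inter (measurableSet_le (by fun_prop) measurable_const)
  refine ae_mem_of_frequently hCm (A := fun t => s t ⁻¹'
    ({e : ℝ × ℝ × ℝ | |φ e.1| ≤ δ} ∩ {e | e.2.1 ≤ γ'})) (fun t => hch.adapted t hH)
    (c := 1 / 2) (by norm_num) 0 ?_
  intro T _ A hA hAH
  have hA' := ℱ.le T _ hA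
  have h1 := hch.setLIntegral_tsum_le hGm hVm hgm hdrift hA
  set Y : Ω → ℝ≥0∞ := fun ω => ∑' k, (stay s G T (T + k)).indicator
        (fun ω => g (s (T + k) ω, ζ (T + k) ω)) ω with hY
  have hYm : Measurable Y := by
    refine Measurable.tsum fun k => Measurable.indicator
        (hgm.comp ((hch.measurable _).prodMk (hch.measurable_noise _)))
        (ℱ.le _ _ (hch.measurableSet_stay hGm T (T + k)))
  have h2 : ∫⁻ ω in A, V (s T ω) ∂P ≤ ENNReal.ofReal (θ / 2) * P A := by
    rw [← setLIntegral_const]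
    refine setLIntegral_mono' hA' fun ω hω => ENNReal.ofReal_le_ofReal ?_
    exact hsmall _ (hs T ω).1 (hAH hω).2
  have h3 := mul_meas_ge_le_lintegral (μ := P.restrict A) hYm (ENNReal.ofReal θ)
  have hYset : MeasurableSet {ω | ENNReal.ofReal θ ≤ Y ω} :=
    measurableSet_le measurable_const hYm
  rw [Measure.restrict_apply hYset] at h3
  have h4 : θ * P.real ({ω | ENNReal.ofReal θ ≤ Y ω} ∩ A) ≤ θ / 2 * P.real A := by
    have := ENNReal.toReal_mono (ENNReal.mul_ne_top ENNReal.ofReal_ne_top (measure_ne_top _ _))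
      (h3.trans (h1.trans h2))
    rwa [ENNReal.toReal_mul, ENNReal.toReal_mul, ENNReal.toReal_ofReal hθ.le,
      ENNReal.toReal_ofReal (by positivity)] at this
  -- `Y` counts increments only until the exit from `G`; the bootstrap shows that on this event
  -- there is no exit.
  have h5 : A \ {ω | ENNReal.ofReal θ ≤ Y ω} ⊆ A ∩ Cv := by
    rintro ω ⟨hωA, hωY⟩
    refine ⟨hωA, ?_⟩
    have hωY' : Y ω ≤ ENNReal.ofReal θ := (not_le.1 hωY).le
    have hinc : ∀ t, |(s (t + 1) ω).1 - (s t ω).1| = (s t ω).2.1 * |φ (s t ω).1 + ζ t ω| := by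
      intro t
      rw [hch.step]
      simp only [update]
      rw [sub_sub_cancel_left, abs_neg, abs_mul, abs_of_pos (hs t ω).1]
    obtain ⟨p, hp⟩ := exists_tendsto_of_sum_rpow_le (X := fun k => (s (T + k) ω).1) hM hδ hlip hε
      hε' (hAH hωA).1 (by
      intro k hk
      have h6 := (ENNReal.sum_le_tsum (Finset.range (k + 1))).trans hωY'
      have h7 : ∀ i ∈ Finset.range (k + 1), (stay s G T (T + i)).indicator
          (fun ω => g (s (T + i) ω, ζ (T + i) ω)) ω
          = ENNReal.ofReal (|(s (T + (i + 1)) ω).1 - (s (T + i) ω).1| ^ ε) := by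
        intro i hi
        have hmem : ω ∈ stay s G T (T + i) := by
          intro j hj1 hj2
          obtain ⟨j, rfl⟩ := Nat.exists_eq_add_of_le hj1
          refine ⟨(hs _ ω).1, (hs _ ω).2, hk j ?_⟩
          have := Finset.mem_range.1 hi
          omega
        rw [indicator_of_mem hmem, ← Nat.add_assoc, hinc]
      rw [Finset.sum_congr rfl h7, ← ENNReal.ofReal_sum_of_nonneg (fun i _ => by positivity)] at h6
      exact (ENNReal.ofReal_le_ofReal_iff hθ.le).1 h6)
    refine ⟨p, ?_⟩
    rw [← tendsto_add_atTop_iff_nat T]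
    simpa [add_comm] using hp
  have h6 : P.real A ≤ P.real ({ω | ENNReal.ofReal θ ≤ Y ω} ∩ A) + P.real (A ∩ Cv) := by
    rw [← measureReal_inter_add_sdiff (s := A) hYset, inter_comm]
    exact add_le_add le_rfl (measureReal_mono h5)
  have h7 : P.real ({ω | ENNReal.ofReal θ ≤ Y ω} ∩ A) ≤ P.real A / 2 := by
    have : θ * P.real ({ω | ENNReal.ofReal θ ≤ Y ω} ∩ A) ≤ θ * (P.real A / 2) := by linarith
    exact le_of_mul_le_mul_left this hθ
  rw [← ofReal_measureReal (μ := P) (s := A), ← ENNReal.ofReal_mul (by norm_num),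
    ← ofReal_measureReal (μ := P) (s := A ∩ Cv)]
  exact ENNReal.ofReal_le_ofReal (by linarith)

end Trap

/-! ### Mean descent of the potential -/

section Descent

variable {φ : ℝ → ℝ} {μ : Measure ℝ} [IsProbabilityMeasure μ] {u d gbar : ℝ}

/-- The potential decreases in mean where the measured gradient dominates the noise. -/
theorem descent_drift (h : SmoothBounded φ) (hμ : CenteredFiniteVariance μ) {m : ℝ}
    (hm : ∀ x, m ≤ potential φ x) {κ δ c : ℝ} (hδ : 0 < δ) (hc : 0 ≤ c)
    (hcκ : c * (1 / δ + (∫ z, |z| ∂μ) / δ ^ 2) ≤ κ)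
    {e : ℝ × ℝ × ℝ} (hγ : 0 < e.2.1) (he : δ ≤ |φ e.1|)
    (hκ : κ * φ e.1 ^ 2 ≤ φ e.1 ^ 2 * (1 - derivSup φ * e.2.1 / 2)
      - derivSup φ * e.2.1 * noiseVariance μ / 2) :
    ∫⁻ z, (ENNReal.ofReal (potential φ (update φ u d gbar e z).1 - m)
      + ENNReal.ofReal (c * (e.2.1 * |φ e.1 + z|))) ∂μ ≤ ENNReal.ofReal (potential φ e.1 - m) := by
  obtain ⟨x, γ, y⟩ := e
  simp only [update] at *
  set M := derivSup φ
  have hi1 : Integrable (fun z : ℝ => z) μ := hμ.1.integrable (by norm_num)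
  have hi2 : Integrable (fun z : ℝ => z ^ 2) μ := hμ.1.integrable_sq
  have hS : noiseVariance μ = ∫ z, z ^ 2 ∂μ := by
    rw [noiseVariance, variance_of_integral_eq_zero hi1.aemeasurable hμ.2]
  set S := noiseVariance μ
  have hI : 0 ≤ ∫ z, |z| ∂μ := integral_nonneg fun z => abs_nonneg z
  set I := ∫ z, |z| ∂μ with hIdef
  set f : ℝ → ℝ := fun z => ((potential φ x - m - γ * φ x ^ 2 + M / 2 * γ ^ 2 * φ x ^ 2
    + c * γ * |φ x|) + (M * γ ^ 2 * φ x - γ * φ x) * z) + (M / 2 * γ ^ 2 * z ^ 2 + c * γ * |z|)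
    with hf
  have hfa : Integrable (fun z : ℝ => (potential φ x - m - γ * φ x ^ 2 + M / 2 * γ ^ 2 * φ x ^ 2
    + c * γ * |φ x|) + (M * γ ^ 2 * φ x - γ * φ x) * z) μ :=
    (integrable_const _).add (hi1.const_mul _)
  have hfb : Integrable (fun z : ℝ => M / 2 * γ ^ 2 * z ^ 2 + c * γ * |z|) μ :=
    (hi2.const_mul _).add (hi1.abs.const_mul _)
  have hfi : Integrable f μ := hfa.add hfb
  have hle : ∀ z, (potential φ (x - γ * (φ x + z)) - m) + c * (γ * |φ x + z|) ≤ f z := by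
    intro z
    have h1 := h.potential_add_le x (-(γ * (φ x + z)))
    rw [← sub_eq_add_neg] at h1
    have h2 : c * (γ * |φ x + z|) ≤ c * γ * |φ x| + c * γ * |z| := by
      have := mul_le_mul_of_nonneg_left (abs_add_le (φ x) z) (mul_nonneg hc hγ.le)
      linarith
    have h3 : f z = (potential φ x + φ x * (-(γ * (φ x + z))) + M / 2 * (-(γ * (φ x + z))) ^ 2)
        - m + (c * γ * |φ x| + c * γ * |z|) := by simp only [hf]; ring
    rw [h3]
    linarith
  have hnn : ∀ z, 0 ≤ f z := fun z => by
    refine le_trans (add_nonneg (sub_nonneg.2 (hm _)) (by positivity)) (hle z)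
  have hint : ∫ z, f z ∂μ ≤ potential φ x - m := by
    rw [hf, integral_add hfa hfb, integral_add (integrable_const _) (hi1.const_mul _),
      integral_add (hi2.const_mul _) (hi1.abs.const_mul _), integral_const_mul, integral_const_mul,
      integral_const_mul, hμ.2, ← hS, ← hIdef, integral_const]
    simp only [probReal_univ, one_smul, mul_zero, add_zero]
    -- Since |φ| ≥ δ, the mean increment, linear in |φ|, is absorbed by the quadratic gain.
    have h1 : c * (|φ x| + I) ≤ κ * φ x ^ 2 := by
      have hsq : |φ x| ^ 2 = φ x ^ 2 := sq_abs _
      have h2 : |φ x| + I ≤ (1 / δ + I / δ ^ 2) * φ x ^ 2 := by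
        rw [← hsq, add_mul]
        refine add_le_add ?_ ?_
        · rw [div_mul_eq_mul_div, le_div_iff₀ hδ]
          nlinarith [abs_nonneg (φ x)]
        · rw [div_mul_eq_mul_div, le_div_iff₀ (by positivity)]
          exact mul_le_mul_of_nonneg_left (pow_le_pow_left₀ hδ.le he 2) hI
      calc c * (|φ x| + I) ≤ c * ((1 / δ + I / δ ^ 2) * φ x ^ 2) := by gcongr
        _ = c * (1 / δ + I / δ ^ 2) * φ x ^ 2 := by ring
        _ ≤ κ * φ x ^ 2 := by gcongr
    have h2 := mul_le_mul_of_nonneg_left (h1.trans hκ) hγ.le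
    linarith
  calc _ ≤ ∫⁻ z, ENNReal.ofReal (f z) ∂μ := lintegral_mono fun z => by
        rw [← ENNReal.ofReal_add (sub_nonneg.2 (hm _)) (by positivity)]
        exact ENNReal.ofReal_le_ofReal (hle z)
    _ = ENNReal.ofReal (∫ z, f z ∂μ) :=
        (ofReal_integral_eq_lintegral_ofReal hfi (Eventually.of_forall hnn)).symm
    _ ≤ _ := ENNReal.ofReal_le_ofReal hint

/-- The states at which the potential decreases in mean. -/
def descentSet (φ : ℝ → ℝ) (μ : Measure ℝ) (κ δ : ℝ) : Set (ℝ × ℝ × ℝ) :=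
  {e | 0 < e.2.1} ∩ ({e | δ ≤ |φ e.1|} ∩
    {e | κ * φ e.1 ^ 2 ≤ φ e.1 ^ 2 * (1 - derivSup φ * e.2.1 / 2)
      - derivSup φ * e.2.1 * noiseVariance μ / 2})

variable {Ω : Type*} [mΩ : MeasurableSpace Ω] {P : Measure Ω} [IsProbabilityMeasure P]
  {ℱ : Filtration ℕ mΩ} {s : ℕ → Ω → ℝ × ℝ × ℝ} {ζ : ℕ → Ω → ℝ}

/-- Paths that eventually stay in the descent set converge. -/
theorem ae_tendsto_of_eventually_descent (h : SmoothBounded φ) (hμ : CenteredFiniteVariance μ)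
    {m : ℝ} (hm : ∀ x, m ≤ potential φ x) {κ δ : ℝ} (hδ : 0 < δ) (hκ : 0 < κ)
    (hch : IsChain P μ (update φ u d gbar) ℱ s ζ) (hs : ∀ t ω, (s t ω).2.1 ∈ Ioc 0 gbar) :
    ∀ᵐ ω ∂P, (∀ᶠ t in atTop, s t ω ∈ descentSet φ μ κ δ) →
      ∃ p, Tendsto (fun t => (s t ω).1) atTop (𝓝 p) := by
  have hc0 : Continuous φ := h.1.continuous
  have hI : 0 ≤ ∫ z, |z| ∂μ := integral_nonneg fun z => abs_nonneg z
  set b := 1 / δ + (∫ z, |z| ∂μ) / δ ^ 2 with hb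
  have hbpos : 0 < b := add_pos_of_pos_of_nonneg (by positivity) (by positivity)
  set c := κ / b with hc
  have hcpos : 0 < c := by positivity
  have hcb : c * b ≤ κ := by rw [hc, div_mul_cancel₀ _ hbpos.ne']
  have hφm : Measurable fun e : ℝ × ℝ × ℝ => φ e.1 := hc0.measurable.comp measurable_fst
  have hG : MeasurableSet (descentSet φ μ κ δ) :=
    (measurableSet_lt measurable_const (by fun_prop)).inter
      ((measurableSet_le measurable_const (continuous_abs.measurable.comp hφm)).inter
        (measurableSet_le (by fun_prop) (by fun_prop)))
  have hV : Measurable fun e : ℝ × ℝ × ℝ => ENNReal.ofReal (potential φ e.1 - m) :=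
    (((continuous_potential hc0).measurable.comp measurable_fst).sub_const m).ennreal_ofReal
  have hg : Measurable fun q : (ℝ × ℝ × ℝ) × ℝ =>
      ENNReal.ofReal (c * (q.1.2.1 * |φ q.1.1 + q.2|)) := by
    have : Continuous fun q : (ℝ × ℝ × ℝ) × ℝ => c * (q.1.2.1 * |φ q.1.1 + q.2|) := by fun_prop
    exact this.measurable.ennreal_ofReal
  have := hch.ae_tsum_lt_top hG hV (fun e => ENNReal.ofReal_ne_top) hg
    (fun e he => descent_drift h hμ hm hδ hcpos.le hcb he.1 he.2.1 he.2.2)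
  filter_upwards [this] with ω hω hev
  obtain ⟨T, hT⟩ := eventually_atTop.1 hev
  have h1 := hω T hT
  -- The dissipation is `c` times the increment, so its summability means finite path length.
  have hinc : ∀ k, c * ((s (T + k) ω).2.1 * |φ (s (T + k) ω).1 + ζ (T + k) ω|)
      = c * |(s (T + (k + 1)) ω).1 - (s (T + k) ω).1| := by
    intro k
    rw [← Nat.add_assoc, hch.step]
    simp only [update]
    rw [sub_sub_cancel_left, abs_neg, abs_mul, abs_of_pos (hs _ ω).1]
  simp only [hinc] at h1
  set A := ∑' k, ENNReal.ofReal (c * |(s (T + (k + 1)) ω).1 - (s (T + k) ω).1|)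
  obtain ⟨p, hp⟩ := exists_tendsto_of_sum_abs_sub_le (X := fun k => (s (T + k) ω).1)
    (c := A.toReal / c) (by
      intro k
      rw [le_div_iff₀ hcpos, mul_comm, Finset.mul_sum, ← ENNReal.ofReal_le_iff_le_toReal h1.ne,
        ENNReal.ofReal_sum_of_nonneg (fun i _ => by positivity)]
      exact ENNReal.sum_le_tsum _)
  refine ⟨p, ?_⟩
  rw [← tendsto_add_atTop_iff_nat T]
  simpa [add_comm] using hp

end Descent

/-! ### Shrinking the step size near the zeros -/

section Reach

variable {φ : ℝ → ℝ} {μ : Measure ℝ} [IsProbabilityMeasure μ] {u d gbar : ℝ}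
  {Ω : Type*} [mΩ : MeasurableSpace Ω] {P : Measure Ω} [IsProbabilityMeasure P]
  {ℱ : Filtration ℕ mΩ} {s : ℕ → Ω → ℝ × ℝ × ℝ} {ζ : ℕ → Ω → ℝ}

/-- States near the zeros of `φ` whose step size is at most `b`. -/
def nearSet (φ : ℝ → ℝ) (η b : ℝ) : Set (ℝ × ℝ × ℝ) :=
  {e | |φ e.1| ≤ η} ∩ ({e | 0 < e.2.1} ∩ {e | e.2.1 ≤ b})

theorem measurableSet_nearSet (hφ : Continuous φ) (η b : ℝ) : MeasurableSet (nearSet φ η b) := by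
  have h1 : Continuous fun e : ℝ × ℝ × ℝ => |φ e.1| := by fun_prop
  exact (measurableSet_le h1.measurable measurable_const).inter
    ((measurableSet_lt measurable_const (by fun_prop)).inter
      (measurableSet_le (by fun_prop) measurable_const))

/-- Noise in an interval of length `τ` next to `-φ x`, on the side opposite to the last sign, gives
a measurement of size at most `τ` that multiplies the step by `d` and moves φ by at most `M * gbar *
τ`. -/
theorem ae_frequently_nearSet_step (hφ : Continuous φ) {M : ℝ} (hM : 0 < M)
    (hlip : ∀ a b, |φ a - φ b| ≤ M * |a - b|) (hatoms : ∀ z : ℝ, μ {z} = 0) {L : ℝ}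
    (hL : ∀ a b : ℝ, -L ≤ a → a < b → b ≤ L → 0 < μ (Ioo a b)) (hd : 0 < d)
    (hch : IsChain P μ (update φ u d gbar) ℱ s ζ) {η b τ : ℝ} (hτ : 0 < τ) (hη : η + τ ≤ L)
    (hb : b ≤ gbar) :
    ∀ᵐ ω ∂P, (∃ᶠ t in atTop, s t ω ∈ nearSet φ η b) →
      ∃ᶠ t in atTop, s t ω ∈ nearSet φ (η + M * gbar * τ) (d * b) := by
  obtain ⟨c, hc, hcL⟩ := exists_forall_le_measure_Ioo hatoms hL hτ
  refine hch.frequently_of_frequently (measurableSet_nearSet hφ _ _) (measurableSet_nearSet hφ _ _)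
    hc ?_
  rintro ⟨x, γ, y⟩ ⟨h1, h2, h3⟩
  change |φ x| ≤ η at h1
  change 0 < γ at h2
  change γ ≤ b at h3
  have hx := abs_le.1 h1
  have key : ∀ z, y * (φ x + z) ≤ 0 → |φ x + z| ≤ τ →
      update φ u d gbar (x, γ, y) z ∈ nearSet φ (η + M * gbar * τ) (d * b) := by
    intro z hz1 hz2
    have e1 : newStep u d gbar γ y (φ x + z) = d * γ := if_neg (not_lt.2 hz1)
    refine ⟨?_, ?_, ?_⟩
    · change |φ (x - γ * (φ x + z))| ≤ _
      have h4 := hlip (x - γ * (φ x + z)) x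
      rw [sub_sub_cancel_left, abs_neg, abs_mul, abs_of_pos h2] at h4
      have h5 : |φ (x - γ * (φ x + z))| ≤ |φ (x - γ * (φ x + z)) - φ x| + |φ x| := by
        simpa using abs_add_le (φ (x - γ * (φ x + z)) - φ x) (φ x)
      have h6 : γ * |φ x + z| ≤ gbar * τ :=
        mul_le_mul (h3.trans hb) hz2 (abs_nonneg _) (by linarith)
      nlinarith
    · change 0 < newStep u d gbar γ y (φ x + z)
      rw [e1]; positivity
    · change newStep u d gbar γ y (φ x + z) ≤ _
      rw [e1]; gcongr
  rcases le_total y 0 with hy | hy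
  · refine (hcL (-φ x) (by linarith) (by linarith)).trans (measure_mono fun z hz => ?_)
    have h4 : 0 < φ x + z := by linarith [hz.1]
    exact key z (mul_nonpos_of_nonpos_of_nonneg hy h4.le)
      (by rw [abs_of_pos h4]; linarith [hz.2])
  · refine (hcL (-φ x - τ) (by linarith) (by linarith)).trans (measure_mono fun z hz => ?_)
    have h4 : φ x + z < 0 := by linarith [hz.2]
    exact key z (mul_nonpos_of_nonneg_of_nonpos hy h4.le)
      (by rw [abs_of_neg h4]; linarith [hz.1])

/-- Near the zeros of `φ`, alternating measurements reduce the step size below any bound. -/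
theorem ae_frequently_nearSet_of_frequently (hφ : Continuous φ) {M : ℝ} (hM : 0 < M)
    (hlip : ∀ a b, |φ a - φ b| ≤ M * |a - b|) (hatoms : ∀ z : ℝ, μ {z} = 0) {L : ℝ}
    (hL : ∀ a b : ℝ, -L ≤ a → a < b → b ≤ L → 0 < μ (Ioo a b)) (hd : 0 < d) (hd' : d < 1)
    (hg : 0 < gbar) (hch : IsChain P μ (update φ u d gbar) ℱ s ζ) {η η' γ₁ : ℝ} (hη : η < η')
    (hηL : η' < L) (hγ₁ : 0 < γ₁) :
    ∀ᵐ ω ∂P, (∃ᶠ t in atTop, s t ω ∈ nearSet φ η gbar) →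
      ∃ᶠ t in atTop, s t ω ∈ nearSet φ η' γ₁ := by
  obtain ⟨N, hN⟩ := exists_pow_lt_of_lt_one (div_pos hγ₁ hg) hd'
  rw [lt_div_iff₀ hg] at hN
  -- `N` alternations bring the step size below `γ₁`; this `τ` keeps their total effect on φ within
  -- `η' - η` and the noise within `[-L, L]`.
  set τ := min (L - η') ((η' - η) / ((N + 1) * (M * gbar))) with hτdef
  have hτ : 0 < τ := lt_min (by linarith) (div_pos (by linarith) (by positivity))
  have hτ2 : N * (M * gbar * τ) ≤ η' - η := by
    have h1 : τ ≤ (η' - η) / ((N + 1) * (M * gbar)) := min_le_right _ _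
    rw [le_div_iff₀ (by positivity)] at h1
    have : 0 < M * gbar * τ := by positivity
    nlinarith
  have hbase : ∀ k : ℕ, k ≤ N → ∀ᵐ ω ∂P, (∃ᶠ t in atTop, s t ω ∈ nearSet φ η gbar) →
      ∃ᶠ t in atTop, s t ω ∈ nearSet φ (η + k * (M * gbar * τ)) (d ^ k * gbar) := by
    intro k
    induction k with
    | zero => intro _; simp
    | succ k ih =>
      intro hk
      have hkN : (k : ℝ) ≤ N := by exact_mod_cast (by omega : k ≤ N)
      have h1 : (k : ℝ) * (M * gbar * τ) ≤ N * (M * gbar * τ) := by gcongr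
      have h2 : d ^ k * gbar ≤ gbar := mul_le_of_le_one_left hg.le (pow_le_one₀ hd.le hd'.le)
      have hτL : τ ≤ L - η' := min_le_left _ _
      filter_upwards [ih (by omega), ae_frequently_nearSet_step hφ hM hlip hatoms hL hd hch
        (η := η + k * (M * gbar * τ)) hτ (by linarith) h2] with ω h3 h4 h5
      convert h4 (h3 h5) using 4
      · push_cast; ring
      · ring
  filter_upwards [hbase N le_rfl] with ω h1 h2
  refine (h1 h2).mono fun t ht => ⟨?_, ht.2.1, ?_⟩
  · exact le_trans (show |φ (s t ω).1| ≤ _ from ht.1) (by linarith)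
  · exact le_trans (show (s t ω).2.1 ≤ _ from ht.2.2) hN.le

/-- States of potential at most `b` whose step size is bounded below, with a weaker bound if the
last measurement has the sign of `φ`. -/
def sublevel (φ : ℝ → ℝ) (gbar g₀ g₁ b : ℝ) : Set (ℝ × ℝ × ℝ) :=
  ({e | g₁ ≤ e.2.1} ∪ ({e | g₀ ≤ e.2.1} ∩ {e | 0 < e.2.2 * φ e.1})) ∩
    ({e | e.2.1 ≤ gbar} ∩ {e | potential φ e.1 ≤ b})

theorem measurableSet_sublevel (hφ : Continuous φ) (g₀ g₁ b : ℝ) :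
    MeasurableSet (sublevel φ gbar g₀ g₁ b) := by
  have h1 : Measurable fun e : ℝ × ℝ × ℝ => φ e.1 := hφ.measurable.comp measurable_fst
  have h2 : Measurable fun e : ℝ × ℝ × ℝ => potential φ e.1 :=
    (continuous_potential hφ).measurable.comp measurable_fst
  exact ((measurableSet_le measurable_const (by fun_prop)).union
    ((measurableSet_le measurable_const (by fun_prop)).inter
      (measurableSet_lt measurable_const (by fun_prop)))).inter
    ((measurableSet_le (by fun_prop) measurable_const).inter
      (measurableSet_le h2 measurable_const))

end Reach

/-! ### Low-noise gradient descent towards the zeros -/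

section GradientDescent

variable {φ : ℝ → ℝ} {μ : Measure ℝ} [IsProbabilityMeasure μ] {u d gbar : ℝ}
  {Ω : Type*} [mΩ : MeasurableSpace Ω] {P : Measure Ω} [IsProbabilityMeasure P]
  {ℱ : Filtration ℕ mΩ} {s : ℕ → Ω → ℝ × ℝ × ℝ} {ζ : ℕ → Ω → ℝ}

/-- Noise that is small relative to φ costs only part of the margin `κ` in the quadratic bound for
an exact gradient step. -/
theorem potential_step_le (h : SmoothBounded φ) (hM : 0 < derivSup φ) {κ x γ z : ℝ}
    (hκ : 0 < κ) (hγ : 0 < γ) (hγκ : derivSup φ * γ / 2 ≤ 1 - κ)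
    (hz : |z| ≤ κ / 8 * |φ x|) :
    potential φ (x - γ * (φ x + z)) ≤ potential φ x - γ * φ x ^ 2 * (κ / 2) := by
  have h1 := h.potential_add_le x (-(γ * (φ x + z)))
  rw [← sub_eq_add_neg] at h1
  set M := derivSup φ
  have hκ1 : κ < 1 := by
    have : 0 < M * γ / 2 := by positivity
    linarith
  have hsq : |φ x| * |φ x| = φ x ^ 2 := by rw [← sq, sq_abs]
  have h2 : -(κ / 8 * φ x ^ 2) ≤ φ x * z := by
    have h3 : |φ x * z| ≤ κ / 8 * φ x ^ 2 := by
      rw [abs_mul, ← hsq]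
      nlinarith [mul_le_mul_of_nonneg_left hz (abs_nonneg (φ x))]
    exact (abs_le.1 h3).1
  have h4 : (φ x + z) ^ 2 ≤ (1 + κ / 8) ^ 2 * φ x ^ 2 := by
    rw [← sq_abs (φ x + z), ← sq_abs (φ x), ← mul_pow]
    exact pow_le_pow_left₀ (abs_nonneg _) (by linarith [abs_add_le (φ x) z]) 2
  have h5 : M / 2 * γ * (φ x + z) ^ 2 ≤ (1 - κ) * ((1 + κ / 8) ^ 2 * φ x ^ 2) := by
    refine mul_le_mul (by linarith) h4 (sq_nonneg _) (by linarith)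
  have h6 : (1 - κ) * (1 + κ / 8) ^ 2 ≤ 1 - κ / 8 - κ / 2 := by nlinarith [mul_pos hκ hκ]
  have h7 : (1 - κ) * ((1 + κ / 8) ^ 2 * φ x ^ 2) ≤ (1 - κ / 8 - κ / 2) * φ x ^ 2 := by
    rw [← mul_assoc]
    exact mul_le_mul_of_nonneg_right h6 (sq_nonneg _)
  have h8 : M / 2 * γ * (φ x + z) ^ 2 - φ x * (φ x + z) ≤ -(φ x ^ 2 * (κ / 2)) := by nlinarith
  have h9 := mul_le_mul_of_nonneg_left h8 hγ.le
  nlinarith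

theorem le_newStep {γ y y' : ℝ} (hu : 1 < u) (hd' : d < 1) (hγ : 0 < γ) (hγ' : γ ≤ gbar) :
    d * γ ≤ newStep u d gbar γ y y' := by
  unfold newStep
  split_ifs
  · exact le_min (by nlinarith) (by nlinarith)
  · exact le_rfl

/-- With small noise the step size stays bounded below away from the zeros of `φ`. -/
theorem update_mem_sublevel (h : SmoothBounded φ) (hM : 0 < derivSup φ)
    (hu : 1 < u) (hd : 0 < d) (hd' : d < 1) {κ η g₀ g₁ b z : ℝ}
    (hκ : 0 < κ) (hκg : derivSup φ * gbar / 2 ≤ 1 - κ) (hη : 0 < η) (hg₀ : 0 < g₀)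
    (hg₁ : g₁ ≤ d / (2 * derivSup φ)) (hg : g₀ ≤ d * g₁) {e : ℝ × ℝ × ℝ}
    (he : e ∈ sublevel φ gbar g₀ g₁ b) (heη : η < |φ e.1|) (hz : |z| ≤ κ / 8 * η) :
    update φ u d gbar e z ∈ sublevel φ gbar g₀ g₁ (b - g₀ * η ^ 2 * (κ / 2)) := by
  obtain ⟨x, γ, y⟩ := e
  obtain ⟨h1, h2, h3⟩ := he
  change γ ≤ gbar at h2
  change potential φ x ≤ b at h3
  change g₁ ≤ γ ∨ (g₀ ≤ γ ∧ 0 < y * φ x) at h1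
  simp only at heη
  have hg₁0 : 0 < g₁ := pos_of_mul_pos_right (hg₀.trans_le hg) hd.le
  have hg01 : g₀ ≤ g₁ := by nlinarith
  have hγ0 : g₀ ≤ γ := by
    rcases h1 with h1 | h1
    · linarith
    · exact h1.1
  have hγ : 0 < γ := hg₀.trans_le hγ0
  have hf : 0 < |φ x| := hη.trans heη
  have hz' : |z| ≤ κ / 8 * |φ x| := hz.trans (by gcongr)
  have hγκ : derivSup φ * γ / 2 ≤ 1 - κ := le_trans (by gcongr) hκg
  have hpot := potential_step_le h hM hκ hγ hγκ hz'
  have hlip := h.abs_sub_le (x - γ * (φ x + z)) x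
  set M := derivSup φ
  have hκ1 : κ < 1 := by
    have : 0 < M * γ / 2 := by positivity
    linarith
  have hsq : |φ x| * |φ x| = φ x ^ 2 := by rw [← sq, sq_abs]
  have hf2 : 0 < φ x ^ 2 := by rw [← hsq]; positivity
  have hfy : 0 < φ x * (φ x + z) := by
    have h4 : |φ x * z| ≤ κ / 8 * φ x ^ 2 := by
      rw [abs_mul, ← hsq]
      nlinarith [mul_le_mul_of_nonneg_left hz' (abs_nonneg (φ x))]
    nlinarith [(abs_le.1 h4).1]
  have hstep := le_newStep (d := d) (y := y) (y' := φ x + z) hu hd' hγ h2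
  refine ⟨?_, ?_, ?_⟩
  · change g₁ ≤ newStep u d gbar γ y (φ x + z) ∨ (g₀ ≤ newStep u d gbar γ y (φ x + z) ∧
      0 < (φ x + z) * φ (x - γ * (φ x + z)))
    -- A step below 1/(2M) cannot flip the sign of φ, so the new measurement agrees with φ at the
    -- new point. The first such step may cost a factor `d`, whence `g₀ ≤ d * g₁`; once the signs
    -- agree, the step is not reduced. A larger step stays above `d / (2 * M)` even when reduced.
    rcases le_total γ (1 / (2 * M)) with h4 | h4
    · right
      constructor
      · rcases h1 with h1 | ⟨h1, h5⟩
        · exact (hg.trans (by gcongr)).trans hstep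
        · have h6 : 0 < y * (φ x + z) := by
            have h7 := mul_pos h5 hfy
            by_contra h8
            nlinarith [mul_nonpos_of_nonneg_of_nonpos hf2.le (not_lt.1 h8)]
          rw [newStep, if_pos h6]
          exact le_min (by nlinarith) (by linarith)
      · rw [sub_sub_cancel_left, abs_neg, abs_mul, abs_of_pos hγ] at hlip
        have h5 : M * γ ≤ 1 / 2 := by
          rw [le_div_iff₀ (by positivity)] at h4
          linarith
        have h6 : |φ x + z| ≤ (1 + κ / 8) * |φ x| := by linarith [abs_add_le (φ x) z]
        have h7 : M * (γ * |φ x + z|) ≤ 1 / 2 * ((1 + κ / 8) * |φ x|) := by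
          rw [← mul_assoc]
          exact mul_le_mul h5 h6 (abs_nonneg _) (by norm_num)
        have h8 : |φ (x - γ * (φ x + z)) - φ x| < |φ x| := by nlinarith
        have h9 : 0 < φ x * φ (x - γ * (φ x + z)) := by
          rcases lt_or_gt_of_ne (abs_pos.1 hf) with h10 | h10
          · rw [abs_of_neg h10] at h8
            exact mul_pos_of_neg_of_neg h10 (by linarith [(abs_lt.1 h8).2])
          · rw [abs_of_pos h10] at h8
            exact mul_pos h10 (by linarith [(abs_lt.1 h8).1])
        have h11 := mul_pos hfy h9
        by_contra h12
        nlinarith [mul_nonpos_of_nonneg_of_nonpos hf2.le (not_lt.1 h12)]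
    · left
      refine le_trans (hg₁.trans ?_) hstep
      calc d / (2 * M) = d * (1 / (2 * M)) := by ring
        _ ≤ d * γ := by gcongr
  · change newStep u d gbar γ y (φ x + z) ≤ gbar
    exact (newStep_mem hu hd hd' ⟨hγ, h2⟩).2
  · change potential φ (x - γ * (φ x + z)) ≤ _
    have h4 : g₀ * η ^ 2 ≤ γ * φ x ^ 2 := by
      have : η ^ 2 ≤ φ x ^ 2 := by
        rw [← sq_abs (φ x)]
        exact pow_le_pow_left₀ hη.le heη.le 2
      gcongr
    nlinarith

/-- From states with bounded potential and not too small step size, the iterates return near the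
zeros of `φ`. -/
theorem ae_frequently_near_of_frequently_sublevel (h : SmoothBounded φ) (hM : 0 < derivSup φ)
    {L : ℝ} (hL0 : 0 < L) (hL : ∀ a b : ℝ, -L ≤ a → a < b → b ≤ L → 0 < μ (Ioo a b))
    (hu : 1 < u) (hd : 0 < d) (hd' : d < 1) {m : ℝ} (hm : ∀ x, m ≤ potential φ x)
    (hch : IsChain P μ (update φ u d gbar) ℱ s ζ) {κ η g₀ g₁ : ℝ}
    (hκ : 0 < κ) (hκg : derivSup φ * gbar / 2 ≤ 1 - κ) (hη : 0 < η) (hg₀ : 0 < g₀)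
    (hg₁ : g₁ ≤ d / (2 * derivSup φ)) (hg : g₀ ≤ d * g₁) (b : ℝ) :
    ∀ᵐ ω ∂P, (∃ᶠ t in atTop, s t ω ∈ sublevel φ gbar g₀ g₁ b) →
      ∃ᶠ t in atTop, |φ (s t ω).1| ≤ η := by
  have hφ : Continuous φ := h.1.continuous
  set τ := min (κ / 8 * η) L with hτdef
  have hτ : 0 < τ := lt_min (by positivity) hL0
  have hτL : τ ≤ L := min_le_right _ _
  have hcpos : 0 < μ.real (Ioo (-τ) τ) :=
    ENNReal.toReal_pos (hL _ _ (by linarith) (by linarith) hτL).ne' (measure_ne_top _ _)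
  set β := g₀ * η ^ 2 * (κ / 2) with hβ
  have hβpos : 0 < β := by positivity
  have hstep : ∀ b, ∀ᵐ ω ∂P,
      (∃ᶠ t in atTop, s t ω ∈ sublevel φ gbar g₀ g₁ b ∩ {e | η < |φ e.1|}) →
      ∃ᶠ t in atTop, s t ω ∈ sublevel φ gbar g₀ g₁ (b - β) := by
    intro b
    have hm1 : MeasurableSet {e : ℝ × ℝ × ℝ | η < |φ e.1|} := by
      have : Continuous fun e : ℝ × ℝ × ℝ => |φ e.1| := by fun_prop
      exact measurableSet_lt measurable_const this.measurable
    refine hch.frequently_of_frequently ((measurableSet_sublevel hφ _ _ _).inter hm1)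
      (measurableSet_sublevel hφ _ _ _) hcpos fun e he => ?_
    rw [ofReal_measureReal]
    refine measure_mono fun z hz => ?_
    exact update_mem_sublevel h hM hu hd hd' hκ hκg hη hg₀ hg₁ hg he.1 he.2
      ((abs_lt.2 hz).le.trans (min_le_left _ _))
  -- Each low-noise step lowers the potential level by `β`; as the potential is at least `m`, the
  -- number of levels is finite and induction on it ends near the zeros.
  have hind : ∀ n : ℕ, ∀ b, b < m + n * β → ∀ᵐ ω ∂P,
      (∃ᶠ t in atTop, s t ω ∈ sublevel φ gbar g₀ g₁ b) → ∃ᶠ t in atTop, |φ (s t ω).1| ≤ η := by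
    intro n
    induction n with
    | zero =>
      intro b hb
      refine Eventually.of_forall fun ω hω => ?_
      obtain ⟨t, ht⟩ := hω.exists
      have h1 : potential φ (s t ω).1 ≤ b := ht.2.2
      have h2 := hm (s t ω).1
      simp only [CharP.cast_eq_zero, zero_mul, add_zero] at hb
      linarith
    | succ n ih =>
      intro b hb
      push_cast at hb
      filter_upwards [ih (b - β) (by linarith), hstep b] with ω h1 h2 h3
      have h4 : ∃ᶠ t in atTop, s t ω ∈ sublevel φ gbar g₀ g₁ b ∩ {e | η < |φ e.1|} ∨
          |φ (s t ω).1| ≤ η := by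
        refine h3.mono fun t ht => ?_
        rcases lt_or_ge η |φ (s t ω).1| with h5 | h5
        · exact Or.inl ⟨ht, h5⟩
        · exact Or.inr h5
      rcases frequently_or_distrib.1 h4 with h5 | h5
      · exact h1 (h2 h5)
      · exact h5
  obtain ⟨n, hn⟩ := exists_nat_gt ((b - m) / β)
  rw [div_lt_iff₀ hβpos] at hn
  exact hind n b (by linarith)

end GradientDescent

/-! ### Almost sure convergence when ud < 1 -/

section Convergence

theorem TailCondition.exists_sq_le {φ : ℝ → ℝ} {μ : Measure ℝ} {gbar : ℝ}
    (h : TailCondition φ μ gbar) :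
    ∃ R I : ℝ, 0 < R ∧ (∀ x : ℝ, R ≤ |x| → 0 < x * φ x) ∧ (∀ x : ℝ, R ≤ |x| → I ≤ φ x ^ 2) ∧
      gbar * derivSup φ * noiseVariance μ / (2 - gbar * derivSup φ) < I := by
  obtain ⟨R, hR, h1, h2⟩ := h
  refine ⟨R, _, hR, h1, fun x hx => csInf_le ⟨0, ?_⟩ (mem_image_of_mem _ (show x ∈ {x : ℝ | R ≤ |x|} from hx)), h2⟩
  rintro _ ⟨x, -, rfl⟩
  positivity

/-- Division by zero gives 0, so `gbar < 2 / derivSup φ` also excludes a vanishing derivative bound.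
-/
theorem derivSup_pos {φ : ℝ → ℝ} {gbar : ℝ} (hg : 0 < gbar) (hg' : gbar < 2 / derivSup φ) : 0 < derivSup φ := by
  by_contra h
  have := div_nonpos_of_nonneg_of_nonpos (zero_le_two (α := ℝ)) (not_lt.1 h)
  linarith

variable {φ : ℝ → ℝ} {μ : Measure ℝ} [IsProbabilityMeasure μ] {u d gbar : ℝ}
  {Ω : Type*} [mΩ : MeasurableSpace Ω] {P : Measure Ω} [IsProbabilityMeasure P]
  {ℱ : Filtration ℕ mΩ} {s : ℕ → Ω → ℝ × ℝ × ℝ} {ζ : ℕ → Ω → ℝ}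

/-- A path eventually in the descent set converges. Any other is infinitely often outside it, hence
infinitely often near the zeros, directly or through a sublevel set, and then infinitely often in
the trap. -/
theorem ae_exists_tendsto (h : SmoothBounded φ) (hμ : CenteredFiniteVariance μ)
    (hatoms : ∀ z : ℝ, μ {z} = 0) (hpos : μ (Ioi 0) = 1 / 2) (hneg : μ (Iio 0) = 1 / 2)
    {L : ℝ} (hL0 : 0 < L) (hL : ∀ a b : ℝ, -L ≤ a → a < b → b ≤ L → 0 < μ (Ioo a b))
    (hg : 0 < gbar) (hg' : gbar < 2 / derivSup φ) (htail : TailCondition φ μ gbar)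
    (hu : 1 < u) (hd : 0 < d) (hd' : d < 1) (hud : u * d < 1)
    (hch : IsChain P μ (update φ u d gbar) ℱ s ζ) (hs : ∀ t ω, (s t ω).2.1 ∈ Ioc 0 gbar) :
    ∀ᵐ ω ∂P, ∃ p, Tendsto (fun t => (s t ω).1) atTop (𝓝 p) := by
  have hφ : Continuous φ := h.1.continuous
  have hM := derivSup_pos hg hg'
  have hlip := h.abs_sub_le
  obtain ⟨R, I, hR, hsign, hsq, hI⟩ := htail.exists_sq_le
  obtain ⟨m, hm⟩ := exists_forall_le_potential hφ hR hsign
  have hint : Integrable (fun z : ℝ => z) μ := hμ.1.integrable (by norm_num)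
  have hS : 0 ≤ noiseVariance μ := variance_nonneg _ _
  set M := derivSup φ with hMdef
  set S := noiseVariance μ
  rw [lt_div_iff₀ hM] at hg'
  set κ := 1 - M * gbar / 2 with hκdef
  have hκ : 0 < κ := by rw [hκdef]; linarith
  have hI0 : 0 < I := lt_of_le_of_lt (div_nonneg (by positivity) (by linarith)) hI
  have hBI : M * gbar * S / 2 < κ * I := by
    rw [div_lt_iff₀ (by linarith)] at hI
    rw [hκdef]; linarith
  obtain ⟨r, hr, hr', hrate⟩ := exists_rate_lt_half hu hd hud
  obtain ⟨ε, hε, hε', hρ⟩ := exists_rpow_contraction (by linarith) hd hrate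
  obtain ⟨a, ha, hab⟩ := exists_sign_change_rate hatoms hpos hneg hr'
  set δ := min (min (a / 2) (L / 2)) (Real.sqrt I) with hδdef
  have hδ : 0 < δ := lt_min (lt_min (by linarith) (by linarith)) (Real.sqrt_pos.2 hI0)
  have hδa : δ ≤ a / 2 := (min_le_left _ _).trans (min_le_left _ _)
  have hδL : δ ≤ L / 2 := (min_le_left _ _).trans (min_le_right _ _)
  have hδI : δ ^ 2 ≤ I := by
    have := pow_le_pow_left₀ hδ.le (min_le_right _ _ : δ ≤ Real.sqrt I) 2
    rwa [Real.sq_sqrt hI0.le] at this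
  obtain ⟨γ₁, hγ₁, htrap⟩ := ae_tendsto_of_frequently_trap hφ hM hlip hatoms hint hu hd hd' hε hε'
    hδ hr hr' hρ (fun b hb => hab b (by linarith)) hch hs
  set η := δ / 2 with hηdef
  have hη : 0 < η := half_pos hδ
  -- At steps below `γ₂`, the noise term is dominated as soon as |φ| ≥ η.
  set γ₂ := min γ₁ (κ * η ^ 2 / (M * (S + 1))) with hγ₂def
  have hγ₂ : 0 < γ₂ := lt_min hγ₁ (by positivity)
  have hγ₂S : M * γ₂ * S ≤ κ * η ^ 2 := by
    have h1 : γ₂ ≤ κ * η ^ 2 / (M * (S + 1)) := min_le_right _ _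
    rw [le_div_iff₀ (by positivity)] at h1
    nlinarith [mul_pos hγ₂ hM]
  -- The first entry serves small steps with |x| < R. The second serves |x| ≥ R at any step up to
  -- `gbar`; its positivity is the tail condition.
  set κ' := min (κ / 2) (κ - M * gbar * S / 2 / I) with hκ'def
  have hκ' : 0 < κ' := by
    refine lt_min (by linarith) ?_
    rw [sub_pos, div_lt_iff₀ hI0]
    exact hBI
  obtain ⟨x₀, -, hx₀⟩ := (isCompact_Icc (a := -R) (b := R)).exists_isMaxOn
    ⟨0, by constructor <;> linarith⟩ (continuous_potential hφ).continuousOn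
  have hmax : ∀ x ∈ Icc (-R) R, potential φ x ≤ potential φ x₀ := isMaxOn_iff.1 hx₀
  set g₁ := min γ₂ (d / (2 * M)) with hg₁def
  have hg₁ : 0 < g₁ := lt_min hγ₂ (by positivity)
  -- Outside the descent set and with |φ| > η, necessarily |x| < R and the step exceeds `γ₂`; the
  -- potential is then at most its maximum over `[-R, R]`.
  have hdich : ∀ t ω, s t ω ∉ descentSet φ μ κ' η →
      s t ω ∈ sublevel φ gbar (d * g₁) g₁ (potential φ x₀) ∨ |φ (s t ω).1| ≤ η := by
    intro t ω hnot
    obtain ⟨hγ, hγg⟩ := hs t ω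
    by_contra! hcon
    obtain ⟨hsub, hφη⟩ := hcon
    refine hnot ⟨hγ, hφη.le, ?_⟩
    change κ' * φ (s t ω).1 ^ 2 ≤ φ (s t ω).1 ^ 2 * (1 - M * (s t ω).2.1 / 2)
      - M * (s t ω).2.1 * S / 2
    set x := (s t ω).1 with hx
    set γ := (s t ω).2.1 with hγdef
    have hMγ : M * γ ≤ M * gbar := by gcongr
    have h1 : φ x ^ 2 * κ ≤ φ x ^ 2 * (1 - M * γ / 2) :=
      mul_le_mul_of_nonneg_left (by rw [hκdef]; linarith) (sq_nonneg _)
    rcases le_or_gt R |x| with hxR | hxR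
    · have h2 : M * gbar * S / 2 ≤ M * gbar * S / 2 / I * φ x ^ 2 := by
        rw [div_mul_eq_mul_div, le_div_iff₀ hI0]
        exact mul_le_mul_of_nonneg_left (hsq x hxR) (by positivity)
      have h3 : M * γ * S ≤ M * gbar * S := by gcongr
      have h4 : κ' * φ x ^ 2 ≤ (κ - M * gbar * S / 2 / I) * φ x ^ 2 :=
        mul_le_mul_of_nonneg_right (min_le_right _ _) (sq_nonneg _)
      linarith
    · have hγ₂' : γ ≤ γ₂ := by
        by_contra hlt
        refine hsub ⟨Or.inl ?_, hγg, ?_⟩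
        · exact (min_le_left _ _).trans (not_le.1 hlt).le
        · exact hmax x (abs_le.1 hxR.le)
      have h2 : M * γ * S ≤ κ * η ^ 2 := le_trans (by gcongr) hγ₂S
      have h3 : η ^ 2 ≤ φ x ^ 2 := by
        rw [← sq_abs (φ x)]
        exact pow_le_pow_left₀ hη.le hφη.le 2
      have h4 : κ' * φ x ^ 2 ≤ κ / 2 * φ x ^ 2 :=
        mul_le_mul_of_nonneg_right (min_le_left _ _) (sq_nonneg _)
      have h5 : κ * η ^ 2 ≤ κ * φ x ^ 2 := by gcongr
      linarith
  filter_upwards [htrap γ₁ le_rfl,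
    ae_frequently_nearSet_of_frequently hφ hM hlip hatoms hL hd hd' hg hch
      (half_lt_self hδ) (by linarith) hγ₁,
    ae_frequently_near_of_frequently_sublevel h hM hL0 hL hu hd hd' hm hch hκ
      (by rw [hκdef]; linarith) hη (mul_pos hd hg₁) (min_le_right _ _) le_rfl (potential φ x₀),
    ae_tendsto_of_eventually_descent h hμ hm hη hκ' hch hs] with ω h1 h2 h3 h4
  by_cases hev : ∀ᶠ t in atTop, s t ω ∈ descentSet φ μ κ' η
  · exact h4 hev
  have h5 : ∃ᶠ t in atTop, |φ (s t ω).1| ≤ η := by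
    rcases frequently_or_distrib.1 ((not_eventually.1 hev).mono fun t ht => hdich t ω ht)
      with h6 | h6
    · exact h3 h6
    · exact h6
  exact h1 ((h2 (h5.mono fun t ht => ⟨ht, hs t ω⟩)).mono fun t ht => ⟨ht.1, ht.2.2⟩)

end Convergence

end StochApprox

/-! ### The theorem -/

open StochApprox in
theorem mainTheorem2 (φ : ℝ → ℝ) (μ : Measure ℝ) [IsProbabilityMeasure μ]
    (hμ : StochApprox.CenteredFiniteVariance μ)
    (hspread : StochApprox.SpreadNearZero μ)
    (hφ : StochApprox.SmoothBounded φ)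
    (hatoms : ∀ z : ℝ, μ {z} = 0)
    (hpos : μ (Ioi 0) = 1 / 2) (hneg : μ (Iio 0) = 1 / 2) :
    ∃ U : ℝ → Set ℝ,
      (∀ a b : ℝ, 0 < a → a ≤ b → b < 1 → U b ⊆ U a) ∧
      (∀ a : ℝ, 0 < a → a < 1 → StochApprox.zeroSet φ ⊆ U a) ∧
      ∀ gbar : ℝ, 0 < gbar → gbar < 2 / StochApprox.derivSup φ →
        StochApprox.TailCondition φ μ gbar →
        Tendsto (fun a => StochApprox.deviation (U a) (StochApprox.zeroSet φ)) (𝓝[<] 1) (𝓝 0) ∧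
        ∀ u d : ℝ, 1 < u → 0 < d → d < 1 →
        ∀ (Ω : Type*) [MeasurableSpace Ω] (P : Measure Ω) [IsProbabilityMeasure P]
          (x γ y ξ : ℕ → Ω → ℝ),
          StochApprox.IsRun φ u d gbar x γ y ξ →
          StochApprox.NoiseCondition P μ x γ ξ →
          (u * d < 1 → ∀ᵐ ω ∂P, ∃ p ∈ U (Real.log u / (-Real.log d)),
            Tendsto (fun t => x t ω) atTop (𝓝 p)) ∧
          (1 < u * d → ∀ᵐ ω ∂P, ¬ ∃ p : ℝ, Tendsto (fun t => x t ω) atTop (𝓝 p)) := by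
  obtain ⟨⟨L, hL0, hL⟩, -⟩ := hspread
  have hc : Continuous φ := hφ.1.continuous
  refine ⟨limitSet φ μ, fun a b _ hab _ => limitSet_anti hab,
    fun a _ ha => zeroSet_subset_limitSet hpos hneg ha, fun gbar hg hg' htail => ⟨?_, ?_⟩⟩
  · obtain ⟨R, I, hR, -, hsq, hI⟩ := htail.exists_sq_le
    have hM := derivSup_pos hg hg'
    have hI0 : 0 < I := by
      rw [lt_div_iff₀ hM] at hg'
      exact lt_of_le_of_lt (div_nonneg (mul_nonneg (by positivity) (variance_nonneg _ _))
        (by linarith)) hI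
    exact tendsto_deviation_limitSet hc hatoms hpos hneg hL0 hL (Real.sqrt_pos.2 hI0)
      fun x hx => Real.sqrt_le_iff.2 ⟨abs_nonneg _, by rw [sq_abs]; exact hsq x hx⟩
  · intro u d hu hd hd' Ω _ P _ x γ y ξ hrun hnoise
    have hlim := ae_growth_nonpos_of_tendsto hc hatoms hL0 hL hu hd hd' hg hrun hnoise
    have hlu : 0 < Real.log u := Real.log_pos hu
    have hld : Real.log d < 0 := Real.log_neg hd hd'
    refine ⟨fun hud => ?_, fun hud => ?_⟩
    · have hconv := ae_exists_tendsto hφ hμ hatoms hpos hneg hL0 hL hg hg' htail hu hd hd' hud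
        (hrun.isChain hc.measurable hnoise) fun t ω => hrun.stepSize_mem hu hd hd' t ω
      filter_upwards [hlim, hconv] with ω h1 h2
      obtain ⟨p, hp⟩ := h2
      have hp' : Tendsto (fun t => x t ω) atTop (𝓝 p) := (tendsto_add_atTop_iff_nat 1).1 hp
      refine ⟨p, ?_, hp'⟩
      rw [mem_limitSet, div_mul_eq_mul_div, div_le_iff₀ (by linarith)]
      linarith [h1 p hp']
    · filter_upwards [hlim] with ω h1
      rintro ⟨p, hp⟩
      have h2 := h1 p hp
      have h3 : 0 < Real.log u + Real.log d := by
        rw [← Real.log_mul (by positivity) hd.ne']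
        exact Real.log_pos hud
      have hs := upProb_add_downProb (φ := φ) hatoms p
      have hq : downProb φ μ p = 1 - upProb φ μ p := by linarith
      rw [hq] at h2
      -- With q = 1 - p, twice the growth is (log u + log d) + (2p - 1)² (log u - log d), which is
      -- positive.
      nlinarith [mul_nonneg (sq_nonneg (2 * upProb φ μ p - 1)) (sub_nonneg.2 (hld.trans hlu).le)]
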